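/- There is an absolute constant $c>0$ (in particular independent of $H,\beta,\sigma$) such that the following holds. Let $H\in(0,1)$, $|\beta|<1$ and $0<\sigma<e^{2|\beta|-1/2}$, and put $C_\beta=e^{-2|\beta|}$. Let $(B^H_t)_{t\in[0,1]}$ be a fractional Brownian motion with Hurst parameter $H$, i.e. a centered Gaussian process with covariance $\mathbb E[B^H_tB^H_s]=\tfrac12(|t|^{2H}+|s|^{2H}-|t-s|^{2H})$, with almost surely continuous paths, and let $X^H$ be a continuous solution on $[0,1]$ of $$dX^H_t=-\beta X^H_t\,dt+\sigma\,dB^H_t,\qquad X^H_0=0 .$$ Then: 1. The equation $dY^H_t=-\beta Y^H_t\,dt+dB^H_t$, $Y^H_0=0$, has a continuous solution on $[0,1]$, and every such solution satisfies, almost surely, $X^H_t=\sigma Y^H_t$ for all $t\in[0,1]$; hence $\mathbb E[\sup_{t\in[0,1]}X^H_t]=\sigma\,\mathbb E[\sup_{t\in[0,1]}Y^H_t]$. 2. $\sup_{t\in[0,1]}X^H_t$ is integrable, and if $|\beta|\le\tfrac14$, then $$\mathbb E\Big[\sup_{t\in[0,1]}X^H_t\Big]\;\ge\;\sigma\,c\,e^{-1/2}\sqrt{\frac1H\log\Big(\frac{C_\beta}{e^{-1/2}}\Big)}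 .$$ 3. The radicand $\frac1H\log(C_\beta/e^{-1/2})$ is nonnegative (so that the bound makes sense) if and only if $|\beta|\le\tfrac14$, and it is positive if and only if $|\beta|<\tfrac14$. -/

import Mathlib

open MeasureTheory ProbabilityTheory

/-- `B` is a (one-dimensional) fractional Brownian motion with Hurst parameter `H` on the time
interval `[0, T]`, in its continuous version: a centered Gaussian process with covariance
`E[B t * B s] = (|t|^(2H) + |s|^(2H) - |t - s|^(2H)) / 2` and almost surely continuous paths.
Only the values `B t` with `t ∈ [0, T]` matter. -/
structure IsFractionalBrownianMotion {Ω : Type*} [MeasurableSpace Ω] (H T : ℝ)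
    (B : ℝ → Ω → ℝ) (P : Measure Ω) : Prop where
  isGaussianProcess : IsGaussianProcess (fun (t : Set.Icc (0 : ℝ) T) (ω : Ω) => B t ω) P
  centered : ∀ t ∈ Set.Icc (0 : ℝ) T, ∫ ω, B t ω ∂P = 0
  covariance : ∀ t ∈ Set.Icc (0 : ℝ) T, ∀ s ∈ Set.Icc (0 : ℝ) T,
    ∫ ω, B t ω * B s ω ∂P
      = (1 / 2) * (|t| ^ (2 * H) + |s| ^ (2 * H) - |t - s| ^ (2 * H))
  continuous_paths : ∀ᵐ ω ∂P, ContinuousOn (fun t => B t ω) (Set.Icc (0 : ℝ) T)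

/-- `X` is a fractional Ornstein-Uhlenbeck process on `[0, T]` driven by `B` and started at zero:
a continuous solution of `dX_t = - β X_t dt + σ dB_t`, `X_0 = 0`, in integral form. The noise is
additive with a constant coefficient, so its integral is `σ (B_t - B_0)`. -/
structure IsFractionalOU {Ω : Type*} [MeasurableSpace Ω] (β σ T : ℝ)
    (B X : ℝ → Ω → ℝ) (P : Measure Ω) : Prop where
  initial : ∀ᵐ ω ∂P, X 0 ω = 0
  continuous_paths : ∀ᵐ ω ∂P, ContinuousOn (fun t => X t ω) (Set.Icc (0 : ℝ) T)
  equation : ∀ᵐ ω ∂P, ∀ t ∈ Set.Icc (0 : ℝ) T,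
    X t ω = X 0 ω + (∫ s in (0 : ℝ)..t, -β * X s ω) + σ * (B t ω - B 0 ω)

/-- The running supremum `sup_{t ∈ [0,1]} X_t`, as a random variable. -/
noncomputable def supOnUnitInterval {Ω : Type*} (X : ℝ → Ω → ℝ) (ω : Ω) : ℝ :=
  ⨆ t : Set.Icc (0 : ℝ) 1, X t ω

/-! The noise is additive, so the equation is solved pathwise by variation of constants. Uniqueness
gives X = σV almost surely, where V = `linearResponse β U` and U is an everywhere continuous version
of B. The radicand is (1/2 - 2|β|)/H, so part 3 is arithmetic, and part 2 follows from E sup V ≥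
const/√H when |β| ≤ 1/4.

Transfer from V to U: U_t = V_t + β∫₀ᵗ V gives sup U ≤ sup V + |β|∫₀¹|V|. As V is centred and V_0 =
0, also E|V_s| ≤ 2 E sup V. Hence E sup U ≤ (1 + 2|β|) E sup V
(`integral_sup_le_mul_integral_sup_linearResponse`).

Lower bound for U: when H ≤ 1/4, the covariance matrix on the grid i/n dominates n^(-2H)/4 times the
identity (`sum_mul_rpow_kernel_ge`). Splitting off an independent white-noise part, Jensen's
inequality compares the maximum with that of n independent Gaussians (`le_integral_maxPosCoord`).
With n about e^(1/H), the factor n^(-2H) stays bounded below while the independent maximum is of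
order √(log n) = 1/√H. When H ≥ 1/4, the single time 1 suffices.

Integrability of the suprema comes from dyadic chaining
(`IsFractionalBrownianMotion.exists_integrable_bound`). -/

/-! ### Positive definiteness of discrete covariance kernels. -/

/-- The distance of two natural numbers, as a natural number. -/
def natGap (i j : ℕ) : ℕ := max i j - min i j

lemma natGap_succ (i j : ℕ) : natGap (i + 1) (j + 1) = natGap i j := by
  unfold natGap; omega

lemma natGap_zero_right (i : ℕ) : natGap i 0 = i := by
  unfold natGap; omega

lemma natGap_zero_left (i : ℕ) : natGap 0 i = i := by
  unfold natGap; omega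

lemma natGap_self (i : ℕ) : natGap i i = 0 := by
  unfold natGap; omega

lemma natGap_pos {i j : ℕ} (h : i ≠ j) : natGap i j ≠ 0 := by
  unfold natGap; omega

lemma cast_natGap (i j : ℕ) : (natGap i j : ℝ) = |(i : ℝ) - j| := by
  unfold natGap
  rcases le_total i j with h | h
  · rw [max_eq_right h, min_eq_left h, Nat.cast_sub h, abs_sub_comm, abs_of_nonneg]
    exact sub_nonneg.2 (by exact_mod_cast h)
  · rw [max_eq_left h, min_eq_right h, Nat.cast_sub h, abs_of_nonneg]
    exact sub_nonneg.2 (by exact_mod_cast h)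

/-- Two windows of length m overlap in m minus their offset, if that is positive. This writes the
kernel m - min(|i - j|, m) as a Gram matrix. -/
lemma sum_overlap_indicator (N m i j : ℕ) (hi : i < N) :
    ∑ l ∈ Finset.range (N + m),
      ((if i ≤ l ∧ l < i + m then (1 : ℝ) else 0) * (if j ≤ l ∧ l < j + m then 1 else 0))
      = m - min (natGap i j : ℝ) m := by
  have h1 : ∀ l, ((if i ≤ l ∧ l < i + m then (1 : ℝ) else 0) *
      (if j ≤ l ∧ l < j + m then 1 else 0))
      = if max i j ≤ l ∧ l < min i j + m then 1 else 0 := by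
    intro l
    rw [ite_zero_mul_ite_zero, one_mul]
    congr 1
    rw [eq_iff_iff]
    omega
  simp_rw [h1]
  rw [Finset.sum_boole]
  have h2 : Finset.filter (fun l => max i j ≤ l ∧ l < min i j + m) (Finset.range (N + m))
      = Finset.Ico (max i j) (min i j + m) := by
    ext l
    simp only [Finset.mem_filter, Finset.mem_range, Finset.mem_Ico]
    omega
  rw [h2, Nat.card_Ico, ← Nat.cast_min, ← Nat.cast_sub (min_le_right _ _)]
  congr 1
  unfold natGap
  omega

/-- The constant m in the Gram kernel is invisible to weights of sum zero, so the form is minus a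
sum of squares. -/
lemma sum_mul_min_natGap_nonpos (N m : ℕ) (b : ℕ → ℝ) (hb : ∑ i ∈ Finset.range N, b i = 0) :
    ∑ i ∈ Finset.range N, ∑ j ∈ Finset.range N, b i * b j * min (natGap i j : ℝ) m ≤ 0 := by
  have key : ∑ l ∈ Finset.range (N + m),
      (∑ i ∈ Finset.range N, b i * (if i ≤ l ∧ l < i + m then (1 : ℝ) else 0)) ^ 2
      = - ∑ i ∈ Finset.range N, ∑ j ∈ Finset.range N, b i * b j * min (natGap i j : ℝ) m := by
    have h0 : ∑ i ∈ Finset.range N, ∑ j ∈ Finset.range N, b i * b j * (m : ℝ) = 0 := by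
      simp_rw [← Finset.sum_mul, ← Finset.mul_sum]
      simp [hb]
    have h2 : ∀ x : ℝ, -x = ∑ i ∈ Finset.range N, ∑ j ∈ Finset.range N, b i * b j * (m : ℝ) - x :=
      fun x => by rw [h0, zero_sub]
    rw [h2, ← Finset.sum_sub_distrib]
    simp_rw [← Finset.sum_sub_distrib, sq, Finset.sum_mul_sum]
    rw [Finset.sum_comm]
    refine Finset.sum_congr rfl fun i hi => ?_
    rw [Finset.sum_comm]
    refine Finset.sum_congr rfl fun j hj => ?_
    rw [← mul_sub, ← sum_overlap_indicator N m i j (Finset.mem_range.1 hi), Finset.mul_sum]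
    refine Finset.sum_congr rfl fun l _ => by ring
  have : 0 ≤ ∑ l ∈ Finset.range (N + m),
      (∑ i ∈ Finset.range N, b i * (if i ≤ l ∧ l < i + m then (1 : ℝ) else 0)) ^ 2 :=
    Finset.sum_nonneg fun _ _ => sq_nonneg _
  linarith

/-- Summation by parts twice. For concave nondecreasing g all coefficients are nonnegative, so g is
a mixture of truncations k ↦ min(k, m). -/
lemma concave_sequence_eq_sum_min (g : ℕ → ℝ) (h0 : g 0 = 0) (M k : ℕ) :
    g (min k (M + 1)) = ∑ m ∈ Finset.range M,
      ((g (m + 1) - g m) - (g (m + 2) - g (m + 1))) * min (k : ℝ) ((m + 1 : ℕ) : ℝ)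
      + (g (M + 1) - g M) * min (k : ℝ) ((M + 1 : ℕ) : ℝ) := by
  induction M with
  | zero =>
    rcases Nat.eq_zero_or_pos k with rfl | hk
    · simp [h0]
    · have : min k 1 = 1 := by omega
      have h2 : min (k : ℝ) 1 = 1 := min_eq_right (by exact_mod_cast hk)
      simp [this, h0, h2]
  | succ M ih =>
    rw [Finset.sum_range_succ]
    have : g (min k (M + 1 + 1)) = g (min k (M + 1)) + (g (M + 2) - g (M + 1)) *
      (min (k : ℝ) ((M + 1 + 1 : ℕ) : ℝ) - min (k : ℝ) ((M + 1 : ℕ) : ℝ)) := by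
      rw [← Nat.cast_min, ← Nat.cast_min]
      rcases Nat.lt_or_ge k (M + 2) with h | h
      · rw [min_eq_left (by omega : k ≤ M + 1 + 1), min_eq_left (by omega : k ≤ M + 1)]
        ring
      · rw [min_eq_right (by omega : M + 1 + 1 ≤ k), min_eq_right (by omega : M + 1 ≤ k)]
        push_cast
        ring
    rw [this, ih]
    ring

/-- A nonnegative nondecreasing concave sequence of the gap is conditionally negative definite. -/
lemma sum_mul_concave_natGap_nonpos (g : ℕ → ℝ) (h0 : g 0 = 0) (hmono : ∀ k, g k ≤ g (k + 1))
    (hconc : ∀ k, g (k + 2) - g (k + 1) ≤ g (k + 1) - g k)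
    (N : ℕ) (b : ℕ → ℝ) (hb : ∑ i ∈ Finset.range N, b i = 0) :
    ∑ i ∈ Finset.range N, ∑ j ∈ Finset.range N, b i * b j * g (natGap i j) ≤ 0 := by
  have h1 : ∀ i ∈ Finset.range N, ∀ j ∈ Finset.range N, b i * b j * g (natGap i j) =
      ∑ m ∈ Finset.range N, ((g (m + 1) - g m) - (g (m + 2) - g (m + 1))) *
        (b i * b j * min (natGap i j : ℝ) ((m + 1 : ℕ) : ℝ))
      + (g (N + 1) - g N) * (b i * b j * min (natGap i j : ℝ) ((N + 1 : ℕ) : ℝ)) := by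
    intro i hi j hj
    rw [Finset.mem_range] at hi hj
    have : natGap i j = min (natGap i j) (N + 1) := by unfold natGap; omega
    conv_lhs => rw [this]
    rw [concave_sequence_eq_sum_min g h0 N, mul_add, Finset.mul_sum]
    congr 1
    · exact Finset.sum_congr rfl fun m _ => by ring
    · ring
  rw [Finset.sum_congr rfl fun i hi => Finset.sum_congr rfl (h1 i hi)]
  simp_rw [Finset.sum_add_distrib, ← Finset.mul_sum]
  have h2 : ∑ i ∈ Finset.range N, ∑ j ∈ Finset.range N, ∑ m ∈ Finset.range N,
      ((g (m + 1) - g m) - (g (m + 2) - g (m + 1))) *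
        (b i * b j * min (natGap i j : ℝ) ((m + 1 : ℕ) : ℝ))
      = ∑ m ∈ Finset.range N, ((g (m + 1) - g m) - (g (m + 2) - g (m + 1))) *
        ∑ i ∈ Finset.range N, ∑ j ∈ Finset.range N,
          (b i * b j * min (natGap i j : ℝ) ((m + 1 : ℕ) : ℝ)) := by
    simp_rw [Finset.mul_sum]
    rw [Finset.sum_comm' (t' := Finset.range N) (s' := fun _ => Finset.range N) (by simp)]
    rw [Finset.sum_congr rfl fun j _ => Finset.sum_comm, Finset.sum_comm]
    exact Finset.sum_congr rfl fun m _ => Finset.sum_comm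
  rw [h2]
  refine add_nonpos (Finset.sum_nonpos fun m _ => ?_) ?_
  · exact mul_nonpos_of_nonneg_of_nonpos (sub_nonneg.2 (hconc m))
      (sum_mul_min_natGap_nonpos N (m + 1) b hb)
  · exact mul_nonpos_of_nonneg_of_nonpos (sub_nonneg.2 (hmono N))
      (sum_mul_min_natGap_nonpos N (N + 1) b hb)

/-- Schoenberg's passage from a conditionally negative kernel to a positive one: adjoin the origin
as an extra point whose weight makes the total zero. -/
lemma sum_mul_kernel_nonneg (g : ℕ → ℝ) (h0 : g 0 = 0) (hmono : ∀ k, g k ≤ g (k + 1))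
    (hconc : ∀ k, g (k + 2) - g (k + 1) ≤ g (k + 1) - g k) (n : ℕ) (a : ℕ → ℝ) :
    0 ≤ ∑ i ∈ Finset.range n, ∑ j ∈ Finset.range n,
      a i * a j * (g (i + 1) + g (j + 1) - g (natGap i j)) := by
  set S := ∑ i ∈ Finset.range n, a i with hS
  let b : ℕ → ℝ := fun i => if i = 0 then -S else a (i - 1)
  have hb : ∑ i ∈ Finset.range (n + 1), b i = 0 := by
    rw [Finset.sum_range_succ']
    simp [b, hS]
  have h := sum_mul_concave_natGap_nonpos g h0 hmono hconc (n + 1) b hb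
  rw [Finset.sum_range_succ'] at h
  simp_rw [Finset.sum_range_succ' _ n] at h
  simp only [b, natGap_succ, natGap_zero_left, natGap_zero_right, h0, if_true,
    Nat.add_one_ne_zero, if_false, Nat.add_sub_cancel] at h
  have e : ∑ i ∈ Finset.range n, ∑ j ∈ Finset.range n,
      a i * a j * (g (i + 1) + g (j + 1) - g (natGap i j))
      = 2 * (S * ∑ i ∈ Finset.range n, a i * g (i + 1))
        - ∑ i ∈ Finset.range n, ∑ j ∈ Finset.range n, a i * a j * g (natGap i j) := by
    simp_rw [mul_sub, mul_add, Finset.sum_sub_distrib, Finset.sum_add_distrib]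
    have e1 : ∑ i ∈ Finset.range n, ∑ j ∈ Finset.range n, a i * a j * g (i + 1)
        = S * ∑ i ∈ Finset.range n, a i * g (i + 1) := by
      rw [hS, Finset.sum_mul_sum, Finset.sum_comm]
      exact Finset.sum_congr rfl fun i _ => Finset.sum_congr rfl fun j _ => by ring
    have e2 : ∑ i ∈ Finset.range n, ∑ j ∈ Finset.range n, a i * a j * g (j + 1)
        = S * ∑ i ∈ Finset.range n, a i * g (i + 1) := by
      rw [hS, Finset.sum_mul_sum]
      exact Finset.sum_congr rfl fun i _ => Finset.sum_congr rfl fun j _ => by ring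
    rw [e1, e2]
    ring
  rw [e]
  have e3 : ∑ i ∈ Finset.range n, a i * -S * g (i + 1)
      = - (S * ∑ i ∈ Finset.range n, a i * g (i + 1)) := by
    rw [← neg_mul, Finset.mul_sum]
    exact Finset.sum_congr rfl fun i _ => by ring
  have e4 : ∑ i ∈ Finset.range n, -S * a i * g (i + 1)
      = - (S * ∑ i ∈ Finset.range n, a i * g (i + 1)) := by
    rw [← neg_mul, Finset.mul_sum]
    exact Finset.sum_congr rfl fun i _ => by ring
  rw [Finset.sum_add_distrib, e3, e4] at h
  linarith

/-- For `2 * H ≤ 1 / 2` the covariance matrix of fractional Brownian motion at the points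
`1, …, n` is at least a quarter of the identity (here without the factor `1 / 2`). -/
lemma sum_mul_rpow_kernel_ge {p : ℝ} (hp0 : 0 < p) (hp : p ≤ 1 / 2) (n : ℕ) (a : ℕ → ℝ) :
    (1 / 2) * ∑ i ∈ Finset.range n, a i ^ 2 ≤ ∑ i ∈ Finset.range n, ∑ j ∈ Finset.range n,
      a i * a j * (((i + 1 : ℕ) : ℝ) ^ p + ((j + 1 : ℕ) : ℝ) ^ p - (natGap i j : ℝ) ^ p) := by
  -- Lowering k^p by 1/2 away from 0 keeps the sequence concave: at k = 0 this is 2^p - 1 ≤ 1/2,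
  -- which p ≤ 1/2 ensures. The amount removed from the kernel is 1/2 plus half the identity.
  let g : ℕ → ℝ := fun k => if k = 0 then 0 else (k : ℝ) ^ p - 1 / 2
  have h2p : (2 : ℝ) ^ p ≤ 3 / 2 := by
    calc (2 : ℝ) ^ p ≤ 2 ^ (1 / 2 : ℝ) := Real.rpow_le_rpow_of_exponent_le (by norm_num) hp
      _ = √2 := (Real.sqrt_eq_rpow 2).symm
      _ ≤ 3 / 2 := by
        rw [Real.sqrt_le_left (by norm_num)]
        norm_num
  have hmono : ∀ k, g k ≤ g (k + 1) := by
    intro k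
    rcases Nat.eq_zero_or_pos k with rfl | hk
    · norm_num [g]
    · simp only [g, hk.ne', if_false, Nat.succ_ne_zero]
      gcongr
      omega
  have hconc : ∀ k, g (k + 2) - g (k + 1) ≤ g (k + 1) - g k := by
    intro k
    rcases Nat.eq_zero_or_pos k with rfl | hk
    · norm_num [g]
      linarith
    · simp only [g, hk.ne', if_false, Nat.succ_ne_zero]
      have := (Real.concaveOn_rpow hp0.le (by linarith : p ≤ 1)).2
        (show (k : ℝ) ∈ Set.Ici (0 : ℝ) from Set.mem_Ici.2 (Nat.cast_nonneg k))
        (show (k : ℝ) + 2 ∈ Set.Ici (0 : ℝ) from by rw [Set.mem_Ici]; positivity) (by norm_num : (0 : ℝ) ≤ 1 / 2)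
        (by norm_num : (0 : ℝ) ≤ 1 / 2) (by norm_num)
      simp only [smul_eq_mul] at this
      have e : 1 / 2 * (k : ℝ) + 1 / 2 * ((k : ℝ) + 2) = k + 1 := by ring
      rw [e] at this
      push_cast
      linarith
  have h := sum_mul_kernel_nonneg g rfl hmono hconc n a
  have e : ∑ i ∈ Finset.range n, ∑ j ∈ Finset.range n,
      a i * a j * (((i + 1 : ℕ) : ℝ) ^ p + ((j + 1 : ℕ) : ℝ) ^ p - (natGap i j : ℝ) ^ p)
      = ∑ i ∈ Finset.range n, ∑ j ∈ Finset.range n,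
      a i * a j * (g (i + 1) + g (j + 1) - g (natGap i j))
      + (1 / 2) * (∑ i ∈ Finset.range n, a i) ^ 2 + (1 / 2) * ∑ i ∈ Finset.range n, a i ^ 2 := by
    have e1 : ∑ i ∈ Finset.range n, a i ^ 2 = ∑ i ∈ Finset.range n, ∑ j ∈ Finset.range n,
        (if i = j then a i * a j else 0) := by
      refine Finset.sum_congr rfl fun i hi => ?_
      rw [Finset.sum_ite_eq, if_pos hi, sq]
    rw [e1, sq, Finset.sum_mul_sum, Finset.mul_sum, Finset.mul_sum, ← Finset.sum_add_distrib,
      ← Finset.sum_add_distrib]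
    refine Finset.sum_congr rfl fun i _ => ?_
    rw [Finset.mul_sum, Finset.mul_sum, ← Finset.sum_add_distrib, ← Finset.sum_add_distrib]
    refine Finset.sum_congr rfl fun j _ => ?_
    by_cases hij : i = j
    · subst hij
      simp only [g, natGap_self, if_true, Nat.succ_ne_zero, if_false, Nat.cast_zero,
        Real.zero_rpow hp0.ne']
      ring
    · simp only [g, hij, natGap_pos hij, Nat.succ_ne_zero, if_false]
      ring
  rw [e]
  nlinarith [sq_nonneg (∑ i ∈ Finset.range n, a i)]

/-! ### Comparing Gaussian maxima with independent ones. -/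

/-- In the characteristic functions the quadratic form of the covariance splits as κ‖t‖² plus a
positive semidefinite remainder, so the law is that of an independent sum. -/
lemma map_toLp_eq_conv_of_posSemidef_sub {ι Ω : Type*} [Fintype ι] [DecidableEq ι]
    [MeasurableSpace Ω] {P : Measure Ω} {X : ι → Ω → ℝ}
    (hX : HasGaussianLaw (fun ω i => X i ω) P) (h0 : ∀ i, ∫ ω, X i ω ∂P = 0) {κ : ℝ} (hκ : 0 ≤ κ)
    (hS : (Matrix.of (fun i j => ∫ ω, X i ω * X j ω ∂P) - κ • (1 : Matrix ι ι ℝ)).PosSemidef) :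
    P.map (fun ω => WithLp.toLp 2 (fun i => X i ω))
      = (stdGaussian (EuclideanSpace ℝ ι)).map (√κ • ·) ∗ multivariateGaussian 0
        (Matrix.of (fun i j => ∫ ω, X i ω * X j ω ∂P) - κ • (1 : Matrix ι ι ℝ)) := by
  have hP := hX.isProbabilityMeasure
  have hX2 := hX.toLp_pi 2
  have hm : ∀ i, MemLp (X i) 2 P := fun i => (hX.eval i).memLp_two
  have : IsProbabilityMeasure ((stdGaussian (EuclideanSpace ℝ ι)).map (√κ • ·)) :=
    Measure.isProbabilityMeasure_map (by fun_prop)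
  have := Measure.isProbabilityMeasure_map hX2.aemeasurable
  apply Measure.ext_of_charFun
  ext t
  have hin : ∀ ω, inner ℝ t (WithLp.toLp 2 (fun i => X i ω)) = ∑ i, t i * X i ω := by
    intro ω
    rw [PiLp.inner_apply]
    exact Finset.sum_congr rfl fun i _ => by simp [mul_comm]
  have hmean : ∫ ω, inner ℝ t (WithLp.toLp 2 (fun i => X i ω)) ∂P = 0 := by
    simp_rw [hin]
    rw [integral_finsetSum _ fun i _ => ((hm i).integrable (by norm_num)).const_mul _]
    simp [integral_const_mul, h0]
  have hvar : Var[fun ω => inner ℝ t (WithLp.toLp 2 (fun i => X i ω)); P]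
      = ∑ i, ∑ j, t i * t j * ∫ ω, X i ω * X j ω ∂P := by
    simp_rw [hin]
    rw [variance_fun_sum fun i => (hm i).const_mul (t i)]
    refine Finset.sum_congr rfl fun i _ => Finset.sum_congr rfl fun j _ => ?_
    rw [covariance_eq_sub ((hm i).const_mul (t i)) ((hm j).const_mul (t j))]
    simp only [integral_const_mul, h0, Pi.mul_apply, mul_zero, sub_zero]
    rw [← integral_const_mul]
    congr 1
    ext ω
    ring
  rw [hX2.charFun_map_eq, hmean, hvar, charFun_conv, charFun_map_smul, charFun_stdGaussian,
    charFun_multivariateGaussian hS, ← Complex.exp_add]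
  congr 1
  have hq : WithLp.ofLp t ⬝ᵥ (Matrix.of (fun i j => ∫ ω, X i ω * X j ω ∂P) - κ • (1 : Matrix ι ι ℝ)).mulVec
      (WithLp.ofLp t) = ∑ i, ∑ j, t i * t j * ∫ ω, X i ω * X j ω ∂P - κ * ‖t‖ ^ 2 := by
    rw [Matrix.sub_mulVec, dotProduct_sub, Matrix.smul_mulVec, Matrix.one_mulVec, dotProduct_smul,
      EuclideanSpace.real_norm_sq_eq]
    congr 1
    · simp only [dotProduct, Matrix.mulVec, Finset.mul_sum, Matrix.of_apply]
      exact Finset.sum_congr rfl fun i _ => Finset.sum_congr rfl fun j _ => by ring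
    · simp [dotProduct, sq]
  rw [hq, norm_smul, ← Complex.ofReal_pow, mul_pow, Real.norm_eq_abs, sq_abs, Real.sq_sqrt hκ]
  push_cast
  simp
  ring

/-- The positive part of the largest coordinate. -/
noncomputable def maxPosCoord {ι : Type*} [Fintype ι] [Nonempty ι] (x : EuclideanSpace ℝ ι) : ℝ :=
  Finset.univ.sup' Finset.univ_nonempty (fun i => max (x i) 0)

section maxPosCoord

variable {ι : Type*} [Fintype ι] [Nonempty ι]

lemma continuous_maxPosCoord : Continuous (maxPosCoord (ι := ι)) := by
  unfold maxPosCoord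
  exact Continuous.finset_sup'_apply _ fun i _ => by fun_prop

lemma le_maxPosCoord (x : EuclideanSpace ℝ ι) (i : ι) : x i ≤ maxPosCoord x :=
  (le_max_left _ _).trans (Finset.le_sup' (fun i => max (x i) 0) (Finset.mem_univ i))

lemma maxPosCoord_nonneg (x : EuclideanSpace ℝ ι) : 0 ≤ maxPosCoord x :=
  (le_max_right _ _).trans
    (Finset.le_sup' (fun i => max (x i) 0) (Finset.mem_univ (Classical.arbitrary ι)))

lemma maxPosCoord_le_norm (x : EuclideanSpace ℝ ι) : maxPosCoord x ≤ ‖x‖ :=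
  Finset.sup'_le _ _ fun i _ => max_le ((le_abs_self _).trans (PiLp.norm_apply_le x i))
    (norm_nonneg x)

lemma integrable_maxPosCoord (μ : Measure (EuclideanSpace ℝ ι)) [IsGaussian μ] :
    Integrable maxPosCoord μ := by
  refine (IsGaussian.integrable_id (μ := μ)).norm.mono'
    continuous_maxPosCoord.aestronglyMeasurable (.of_forall fun x => ?_)
  rw [Real.norm_of_nonneg (maxPosCoord_nonneg x)]
  exact maxPosCoord_le_norm x

end maxPosCoord

lemma stdGaussian_real_exists_coord_ge (ι : Type*) [Fintype ι] (u : ℝ) :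
    (stdGaussian (EuclideanSpace ℝ ι)).real {x | ∃ i, u ≤ x i}
      = 1 - (gaussianReal 0 1).real (Set.Iio u) ^ Fintype.card ι := by
  have hset : {x : EuclideanSpace ℝ ι | ∃ i, u ≤ x i} = {x | ∀ i, x i < u}ᶜ := by
    ext x
    simp
  have hms : MeasurableSet {x : EuclideanSpace ℝ ι | ∀ i, x i < u} := by
    simp_rw [Set.ofPred_forall]
    exact MeasurableSet.iInter fun i => measurableSet_lt (by fun_prop) measurable_const
  rw [hset, probReal_compl_eq_one_sub hms]
  congr 1
  rw [← map_pi_eq_stdGaussian, map_measureReal_apply (by fun_prop) hms]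
  have : WithLp.toLp 2 ⁻¹' {x : EuclideanSpace ℝ ι | ∀ i, x i < u}
      = Set.univ.pi fun _ : ι => Set.Iio u := by
    ext x
    simp
  rw [this, measureReal_def, Measure.pi_pi]
  simp [measureReal_def]

/-- If the covariance matrix of a centred Gaussian vector is at least `κ` times the identity, then
its maximum is on average at least as large as for independent variables of variance `κ`. -/
lemma le_integral_maxPosCoord {ι Ω : Type*} [Fintype ι] [DecidableEq ι] [Nonempty ι]
    [MeasurableSpace Ω] {P : Measure Ω} {X : ι → Ω → ℝ}
    (hX : HasGaussianLaw (fun ω i => X i ω) P) (h0 : ∀ i, ∫ ω, X i ω ∂P = 0) {κ : ℝ} (hκ : 0 ≤ κ)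
    (hS : (Matrix.of (fun i j => ∫ ω, X i ω * X j ω ∂P) - κ • (1 : Matrix ι ι ℝ)).PosSemidef)
    (u : ℝ) :
    √κ * u * (1 - (gaussianReal 0 1).real (Set.Iio u) ^ Fintype.card ι)
      ≤ ∫ ω, maxPosCoord (WithLp.toLp 2 (fun i => X i ω)) ∂P := by
  have hX2 := hX.toLp_pi 2
  have hg := hX2.isGaussian_map
  have hlaw := map_toLp_eq_conv_of_posSemidef_sub hX h0 hκ hS
  rw [← integral_map (f := maxPosCoord) hX2.aemeasurable
    continuous_maxPosCoord.aestronglyMeasurable]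
  rw [hlaw] at hg ⊢
  set ν := multivariateGaussian 0
        (Matrix.of (fun i j => ∫ ω, X i ω * X j ω ∂P) - κ • (1 : Matrix ι ι ℝ)) with hν
  have hprob : IsProbabilityMeasure ((stdGaussian (EuclideanSpace ℝ ι)).map (√κ • ·)) :=
    Measure.isProbabilityMeasure_map (by fun_prop)
  have hint := integrable_maxPosCoord
    ((stdGaussian (EuclideanSpace ℝ ι)).map (√κ • ·) ∗ ν)
  have hsec : ∀ x, Integrable (fun y => maxPosCoord (x + y)) ν := by
    intro x
    refine ((integrable_const ‖x‖).add (IsGaussian.integrable_id (μ := ν)).norm).mono'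
      (continuous_maxPosCoord.comp (continuous_const.add continuous_id)).aestronglyMeasurable
      (.of_forall fun y => ?_)
    rw [Real.norm_of_nonneg (maxPosCoord_nonneg _)]
    exact (maxPosCoord_le_norm _).trans (norm_add_le x y)
  -- Jensen's inequality: averaging over the centred remainder cannot lower the maximum.
  have hlow : ∀ x, ∀ i, x i ≤ ∫ y, maxPosCoord (x + y) ∂ν := by
    intro x i
    have hi : Integrable (fun y : EuclideanSpace ℝ ι => y i) ν :=
      (EuclideanSpace.proj (𝕜 := ℝ) i).integrable_comp (IsGaussian.integrable_id (μ := ν))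
    have hi0 : ∫ y : EuclideanSpace ℝ ι, y i ∂ν = 0 := by
      have := (EuclideanSpace.proj (𝕜 := ℝ) i).integral_comp_comm
        (IsGaussian.integrable_id (μ := ν))
      simp only [id_eq, hν, integral_id_multivariateGaussian] at this
      simpa using this
    calc x i = ∫ y, (x i + y i) ∂ν := by
          rw [integral_add (integrable_const _) hi, hi0]
          simp
      _ ≤ _ := integral_mono ((integrable_const _).add hi) (hsec x)
        fun y => le_maxPosCoord (x + y) i
  have hlow0 : ∀ x, 0 ≤ ∫ y, maxPosCoord (x + y) ∂ν :=
    fun x => integral_nonneg fun y => maxPosCoord_nonneg _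
  have hcont : StronglyMeasurable fun x => ∫ y, maxPosCoord (x + y) ∂ν :=
    StronglyMeasurable.integral_prod_right'
      (f := fun p : EuclideanSpace ℝ ι × EuclideanSpace ℝ ι => maxPosCoord (p.1 + p.2))
      (continuous_maxPosCoord.comp (continuous_fst.add continuous_snd)).stronglyMeasurable
  have hint2 := ((integrable_conv_iff hint.aestronglyMeasurable).1 hint).2
  simp_rw [Real.norm_of_nonneg (maxPosCoord_nonneg _)] at hint2
  rw [integral_conv hint, integral_map (by fun_prop) hcont.aestronglyMeasurable,
    ← stdGaussian_real_exists_coord_ge]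
  have hint3 := (integrable_map_measure hcont.aestronglyMeasurable (by fun_prop)).1 hint2
  have hms : MeasurableSet {x : EuclideanSpace ℝ ι | ∃ i, u ≤ x i} := by
    simp_rw [Set.ofPred_exists]
    exact MeasurableSet.iUnion fun i => measurableSet_le measurable_const (by fun_prop)
  -- Markov's inequality read backwards. Taking positive parts makes the contribution off the event
  -- nonnegative.
  calc √κ * u * (stdGaussian (EuclideanSpace ℝ ι)).real {x | ∃ i, u ≤ x i}
      = ∫ x, Set.indicator {x : EuclideanSpace ℝ ι | ∃ i, u ≤ x i} (fun _ => √κ * u) x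
          ∂(stdGaussian (EuclideanSpace ℝ ι)) := by
        rw [integral_indicator_const _ hms, smul_eq_mul, mul_comm]
    _ ≤ _ := by
        refine integral_mono ((integrable_const _).indicator hms) hint3 fun x => ?_
        simp only [Set.indicator_apply, Set.mem_ofPred_eq]
        split_ifs with h
        · obtain ⟨i, hi⟩ := h
          refine le_trans ?_ (hlow (√κ • x) i)
          simpa using mul_le_mul_of_nonneg_left hi (Real.sqrt_nonneg κ)
        · exact hlow0 _

/-- On [u, u + 1] the density is at least its value at the right end. -/
lemma exp_neg_sq_le_gaussianReal_Ici {u : ℝ} (hu : 0 ≤ u) :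
    (√(2 * Real.pi))⁻¹ * Real.exp (-(u + 1) ^ 2 / 2) ≤ (gaussianReal 0 1).real (Set.Ici u) := by
  have hI := (integrable_gaussianPDFReal 0 1).integrableOn (s := Set.Icc u (u + 1))
  calc (√(2 * Real.pi))⁻¹ * Real.exp (-(u + 1) ^ 2 / 2)
      = ∫ x in Set.Icc u (u + 1), (√(2 * Real.pi))⁻¹ * Real.exp (-(u + 1) ^ 2 / 2) := by
        simp
    _ ≤ ∫ x in Set.Icc u (u + 1), gaussianPDFReal 0 1 x := by
        refine setIntegral_mono_on (integrableOn_const (by simp)) hI measurableSet_Icc fun x hx => ?_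
        rw [gaussianPDFReal]
        simp only [NNReal.coe_one, mul_one, sub_zero]
        gcongr
        · linarith [hx.1]
        · exact hx.2
    _ = (gaussianReal 0 1).real (Set.Icc u (u + 1)) := by
        rw [measureReal_def, gaussianReal_apply_eq_integral 0 one_ne_zero, ENNReal.toReal_ofReal]
        exact integral_nonneg fun x => gaussianPDFReal_nonneg _ _ _
    _ ≤ _ := measureReal_mono Set.Icc_subset_Ici_self

/-! ### Continuous versions of fractional Brownian motion. -/

lemma IsFractionalBrownianMotion.ae_zero_eq_zero {Ω : Type*} [MeasurableSpace Ω] {P : Measure Ω}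
    {H : ℝ} {B : ℝ → Ω → ℝ} (hH : 0 < H) (hB : IsFractionalBrownianMotion H 1 B P) :
    ∀ᵐ ω ∂P, B 0 ω = 0 := by
  have h0 : (0 : ℝ) ∈ Set.Icc (0 : ℝ) 1 := by simp
  have hm : MemLp (B 0) 2 P := (hB.isGaussianProcess.hasGaussianLaw_eval ⟨0, h0⟩).memLp_two
  have h := hB.covariance 0 h0 0 h0
  have hint : Integrable (fun ω => B 0 ω * B 0 ω) P := hm.integrable_mul hm
  have hp : 2 * H ≠ 0 := by positivity
  simp only [abs_zero, sub_zero, Real.zero_rpow hp] at h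
  norm_num at h
  rw [integral_eq_zero_iff_of_nonneg (fun ω => mul_self_nonneg _) hint] at h
  filter_upwards [h] with ω hω
  simpa using hω

/-- A fractional Brownian motion coincides on the unit interval, almost surely, with one all of
whose paths are continuous and start at zero. -/
lemma IsFractionalBrownianMotion.exists_continuous_version {Ω : Type*} [MeasurableSpace Ω]
    {P : Measure Ω} {H : ℝ} {B : ℝ → Ω → ℝ} (hH : 0 < H)
    (hB : IsFractionalBrownianMotion H 1 B P) :
    ∃ U : ℝ → Ω → ℝ, IsFractionalBrownianMotion H 1 U P ∧ (∀ ω, Continuous fun t => U t ω) ∧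
      (∀ t, Measurable (U t)) ∧ (∀ ω, U 0 ω = 0) ∧
      ∀ᵐ ω ∂P, ∀ t ∈ Set.Icc (0 : ℝ) 1, B t ω = U t ω := by
  classical
  have hae : ∀ t : Set.Icc (0 : ℝ) 1, AEMeasurable (B t) P :=
    fun t => hB.isGaussianProcess.aemeasurable t
  let d : ℕ → Set.Icc (0 : ℝ) 1 := TopologicalSpace.denseSeq _
  have hgood : ∀ᵐ ω ∂P, ContinuousOn (fun t => B t ω) (Set.Icc (0 : ℝ) 1) ∧ B 0 ω = 0 ∧
      ∀ n, B (d n) ω = (hae (d n)).mk _ ω := by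
    filter_upwards [hB.continuous_paths, hB.ae_zero_eq_zero hH,
      ae_all_iff.2 fun n => (hae (d n)).ae_eq_mk] with ω h1 h2 h3 using ⟨h1, h2, h3⟩
  obtain ⟨N, hN, hNm, hN0⟩ := exists_measurable_superset_of_null (ae_iff.1 hgood)
  have hNc : ∀ ω, ω ∉ N → ContinuousOn (fun t => B t ω) (Set.Icc (0 : ℝ) 1) ∧ B 0 ω = 0 ∧
      ∀ n, B (d n) ω = (hae (d n)).mk _ ω := fun ω hω => by
    by_contra h
    exact hω (hN h)
  -- Paths are set to zero on a measurable null set containing all bad ω, and frozen outside the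
  -- unit interval.
  let U : ℝ → Ω → ℝ := fun t ω => if ω ∈ N then 0 else B (Set.projIcc 0 1 zero_le_one t) ω
  have hUc : ∀ ω, Continuous fun t => U t ω := by
    intro ω
    by_cases hω : ω ∈ N
    · simp only [U, hω, if_true]
      exact continuous_const
    · simp only [U, hω, if_false]
      exact (continuousOn_iff_continuous_domRestrict.1 (hNc ω hω).1).comp continuous_projIcc
  have hUm : ∀ t, Measurable (U t) := by
    intro t
    -- Each B t is only a.e. measurable, so measurable representatives are fixed at countably many
    -- dense times; continuity carries measurability to every t.
    have hd : Set.projIcc (0 : ℝ) 1 zero_le_one t ∈ closure (Set.range d) :=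
      TopologicalSpace.denseRange_denseSeq _ _
    obtain ⟨x, hx, hlim⟩ := mem_closure_iff_seq_limit.1 hd
    have hxm : ∀ n, Measurable (U (x n)) := by
      intro n
      obtain ⟨k, hk⟩ := hx n
      have : U (x n) = fun ω => if ω ∈ N then 0 else (hae (d k)).mk _ ω := by
        ext ω
        by_cases hω : ω ∈ N
        · simp [U, hω]
        · simp only [U, hω, if_false, Set.projIcc_val]
          rw [← (hNc ω hω).2.2 k, hk]
      rw [this]
      exact Measurable.ite hNm measurable_const (hae (d k)).measurable_mk
    refine measurable_of_tendsto_metrizable hxm (tendsto_pi_nhds.2 fun ω => ?_)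
    have h1 : U t ω = U (Set.projIcc (0 : ℝ) 1 zero_le_one t) ω := by
      simp only [U, Set.projIcc_val]
    rw [h1]
    exact ((hUc ω).tendsto _).comp ((continuous_subtype_val.tendsto _).comp hlim)
  have hU0 : ∀ ω, U 0 ω = 0 := by
    intro ω
    by_cases hω : ω ∈ N
    · simp [U, hω]
    · simp only [U, hω, if_false]
      rw [Set.projIcc_left]
      exact (hNc ω hω).2.1
  have hBU : ∀ᵐ ω ∂P, ∀ t ∈ Set.Icc (0 : ℝ) 1, B t ω = U t ω := by
    filter_upwards [measure_eq_zero_iff_ae_notMem.1 hN0] with ω hω t ht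
    simp only [U, hω, if_false]
    rw [Set.projIcc_of_mem _ ht]
  have hBU' : ∀ t ∈ Set.Icc (0 : ℝ) 1, B t =ᵐ[P] U t := fun t ht => by
    filter_upwards [hBU] with ω h using h t ht
  refine ⟨U, ⟨hB.isGaussianProcess.congr fun t => hBU' t t.2, fun t ht => ?_, fun t ht s hs => ?_,
    .of_forall fun ω => (hUc ω).continuousOn⟩, hUc, hUm, hU0, hBU⟩
  · rw [← hB.centered t ht]
    exact integral_congr_ae (hBU' t ht).symm
  · rw [← hB.covariance t ht s hs]
    exact integral_congr_ae ((hBU' t ht).symm.mul (hBU' s hs).symm)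

/-! ### The supremum functional. -/

section supOnUnitInterval

variable {Ω : Type*} {U : ℝ → Ω → ℝ} {ω : Ω}

lemma bddAbove_range_of_continuous (hU : Continuous fun t => U t ω) :
    BddAbove (Set.range fun t : Set.Icc (0 : ℝ) 1 => U t ω) :=
  isCompact_range (hU.comp continuous_subtype_val) |>.bddAbove

lemma le_supOnUnitInterval (hU : Continuous fun t => U t ω) {t : ℝ} (ht : t ∈ Set.Icc (0 : ℝ) 1) :
    U t ω ≤ supOnUnitInterval U ω :=
  le_ciSup (bddAbove_range_of_continuous hU) (⟨t, ht⟩ : Set.Icc (0 : ℝ) 1)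

lemma supOnUnitInterval_le {a : ℝ} (h : ∀ t ∈ Set.Icc (0 : ℝ) 1, U t ω ≤ a) :
    supOnUnitInterval U ω ≤ a :=
  ciSup_le fun t => h t t.2

lemma supOnUnitInterval_congr {V : ℝ → Ω → ℝ} (h : ∀ t ∈ Set.Icc (0 : ℝ) 1, U t ω = V t ω) :
    supOnUnitInterval U ω = supOnUnitInterval V ω :=
  iSup_congr fun t => h t t.2

lemma measurable_supOnUnitInterval [MeasurableSpace Ω] (hU : ∀ ω, Continuous fun t => U t ω)
    (hm : ∀ t, Measurable (U t)) : Measurable (supOnUnitInterval U) := by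
  obtain ⟨D, hDc, hD⟩ := TopologicalSpace.exists_countable_dense (Set.Icc (0 : ℝ) 1)
  have : supOnUnitInterval U = fun ω => ⨆ s : D, U (s : Set.Icc (0 : ℝ) 1) ω := by
    ext ω
    exact (hD.ciSup ((hU ω).comp continuous_subtype_val) (bddAbove_range_of_continuous (hU ω))).symm
  rw [this]
  have := hDc.to_subtype
  exact Measurable.iSup fun s => hm _

end supOnUnitInterval

/-! ### Lower bound for fractional Brownian motion. -/

section lowerBound

variable {Ω : Type*} [MeasurableSpace Ω] {P : Measure Ω} {H : ℝ} {U : ℝ → Ω → ℝ}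

lemma IsFractionalBrownianMotion.le_integral_sup (hB : IsFractionalBrownianMotion H 1 U P)
    (hc : ∀ ω, Continuous fun t => U t ω) (h0 : ∀ ω, U 0 ω = 0)
    (hint : Integrable (supOnUnitInterval U) P) {n : ℕ} (hn : n ≠ 0) (τ : Fin n → ℝ)
    (hτ : ∀ i, τ i ∈ Set.Icc (0 : ℝ) 1) {κ : ℝ} (hκ : 0 ≤ κ)
    (hS : (Matrix.of (fun i j => (1 / 2) * (|τ i| ^ (2 * H) + |τ j| ^ (2 * H)
      - |τ i - τ j| ^ (2 * H))) - κ • (1 : Matrix (Fin n) (Fin n) ℝ)).PosSemidef) (u : ℝ) :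
    √κ * u * (1 - (gaussianReal 0 1).real (Set.Iio u) ^ n)
      ≤ ∫ ω, supOnUnitInterval U ω ∂P := by
  have : Nonempty (Fin n) := ⟨⟨0, Nat.pos_of_ne_zero hn⟩⟩
  have hG : HasGaussianLaw (fun ω (i : Fin n) => U (τ i) ω) P := by
    let f : Fin n → Set.Icc (0 : ℝ) 1 := fun i => ⟨τ i, hτ i⟩
    let I : Finset (Fin n) := Finset.univ
    have := (hB.isGaussianProcess.comp_right f).hasGaussianLaw I
    let L : (I → ℝ) →L[ℝ] (Fin n → ℝ) :=
      ContinuousLinearMap.pi fun i => ContinuousLinearMap.proj ⟨i, Finset.mem_univ i⟩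
    exact this.map_fun L
  have hcov : (fun i j => ∫ ω, U (τ i) ω * U (τ j) ω ∂P) = fun i j =>
      (1 / 2) * (|τ i| ^ (2 * H) + |τ j| ^ (2 * H) - |τ i - τ j| ^ (2 * H)) := by
    ext i j
    exact hB.covariance _ (hτ i) _ (hτ j)
  have key := le_integral_maxPosCoord hG (fun i => hB.centered _ (hτ i)) hκ
    (by rw [hcov]; exact hS) (u := u)
  rw [Fintype.card_fin] at key
  refine key.trans (integral_mono ?_ hint fun ω => ?_)
  · have hX2 := hG.toLp_pi 2
    have := hX2.isGaussian_map
    exact (integrable_map_measure continuous_maxPosCoord.aestronglyMeasurable hX2.aemeasurable).1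
      (integrable_maxPosCoord _)
  -- The path starts at zero, so its supremum also dominates the positive part.
  · refine Finset.sup'_le _ _ fun i _ => max_le (le_supOnUnitInterval (hc ω) (hτ i)) ?_
    rw [← h0 ω]
    exact le_supOnUnitInterval (hc ω) (by simp)

/-- Self-similarity reduces the grid to the integers 1, …, n. The 1/4 is the covariance factor 1/2
times the 1/2 of `sum_mul_rpow_kernel_ge`, whose exponent is 2H ≤ 1/2. -/
lemma posSemidef_covariance_grid_sub (hH : 0 < H) (hH4 : H ≤ 1 / 4) {n : ℕ} (hn : n ≠ 0) :
    (Matrix.of (fun i j : Fin n => (1 / 2) * (|((i + 1 : ℕ) : ℝ) / n| ^ (2 * H)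
      + |((j + 1 : ℕ) : ℝ) / n| ^ (2 * H) - |((i + 1 : ℕ) : ℝ) / n - ((j + 1 : ℕ) : ℝ) / n| ^ (2 * H)))
      - ((n : ℝ) ^ (-(2 * H)) / 4) • (1 : Matrix (Fin n) (Fin n) ℝ)).PosSemidef := by
  have hn0 : (0 : ℝ) < n := by exact_mod_cast Nat.pos_of_ne_zero hn
  have hent : ∀ i j : Fin n, (1 / 2) * (|((i + 1 : ℕ) : ℝ) / n| ^ (2 * H)
      + |((j + 1 : ℕ) : ℝ) / n| ^ (2 * H)
      - |((i + 1 : ℕ) : ℝ) / n - ((j + 1 : ℕ) : ℝ) / n| ^ (2 * H))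
      = (n : ℝ) ^ (-(2 * H)) / 2 * (((i + 1 : ℕ) : ℝ) ^ (2 * H) + ((j + 1 : ℕ) : ℝ) ^ (2 * H)
        - (natGap i j : ℝ) ^ (2 * H)) := by
    intro i j
    have hdiv : ∀ x : ℝ, |x / n| ^ (2 * H) = (n : ℝ) ^ (-(2 * H)) * |x| ^ (2 * H) := by
      intro x
      rw [abs_div, abs_of_pos hn0, Real.div_rpow (abs_nonneg _) hn0.le, Real.rpow_neg hn0.le,
        div_eq_inv_mul]
    rw [← sub_div, hdiv, hdiv, hdiv, Nat.abs_cast, Nat.abs_cast, cast_natGap]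
    push_cast
    rw [add_sub_add_right_eq_sub]
    ring
  refine Matrix.PosSemidef.of_dotProduct_mulVec_nonneg ?_ fun x => ?_
  · ext i j
    simp only [Matrix.conjTranspose_apply, Matrix.sub_apply, Matrix.smul_apply, Matrix.of_apply,
      star_trivial, Matrix.one_apply, eq_comm (a := j)]
    rw [abs_sub_comm (((j : ℕ) + 1 : ℕ) / (n : ℝ))]
    ring
  · have h := sum_mul_rpow_kernel_ge (p := 2 * H) (by positivity) (by linarith) n
      (fun k => if h : k < n then x ⟨k, h⟩ else 0)
    simp only [Finset.sum_range, Fin.is_lt, dite_true, Fin.eta] at h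
    have e : star x ⬝ᵥ (Matrix.of (fun i j : Fin n => (1 / 2) * (|((i + 1 : ℕ) : ℝ) / n| ^ (2 * H)
      + |((j + 1 : ℕ) : ℝ) / n| ^ (2 * H) - |((i + 1 : ℕ) : ℝ) / n - ((j + 1 : ℕ) : ℝ) / n| ^ (2 * H)))
      - ((n : ℝ) ^ (-(2 * H)) / 4) • (1 : Matrix (Fin n) (Fin n) ℝ)).mulVec x
      = (n : ℝ) ^ (-(2 * H)) / 2 * (∑ i : Fin n, ∑ j : Fin n, x i * x j *
        (((i + 1 : ℕ) : ℝ) ^ (2 * H) + ((j + 1 : ℕ) : ℝ) ^ (2 * H) - (natGap i j : ℝ) ^ (2 * H))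
        - 1 / 2 * ∑ i, x i ^ 2) := by
      rw [Matrix.sub_mulVec, dotProduct_sub, Matrix.smul_mulVec, Matrix.one_mulVec,
        dotProduct_smul, mul_sub]
      congr 1
      · simp only [dotProduct, Matrix.mulVec, Finset.mul_sum, Matrix.of_apply, hent, star_trivial]
        exact Finset.sum_congr rfl fun i _ => Finset.sum_congr rfl fun j _ => by ring
      · simp only [dotProduct, star_trivial, smul_eq_mul, sq]
        ring
    rw [e]
    exact mul_nonneg (by positivity) (sub_nonneg.2 h)

/-- If the upper tail at u is at least q, the power is at most (1 - q)^n ≤ e^(-nq). The simple q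
comes from √(2π) ≤ e and (u + 1)²/2 ≤ u² + 1. -/
lemma gaussianReal_Iio_pow_le (n : ℕ) {u : ℝ} (hu : 0 ≤ u) :
    (gaussianReal 0 1).real (Set.Iio u) ^ n
      ≤ Real.exp (-(n * Real.exp (-(u ^ 2 + 2)))) := by
  have h1 : Real.exp (-(u ^ 2 + 2)) ≤ (gaussianReal 0 1).real (Set.Ici u) := by
    refine le_trans ?_ (exp_neg_sq_le_gaussianReal_Ici hu)
    have h2 : √(2 * Real.pi) ≤ Real.exp 1 := by
      rw [Real.sqrt_le_left (Real.exp_pos 1).le]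
      nlinarith [Real.pi_lt_d2, Real.exp_one_gt_d9]
    calc Real.exp (-(u ^ 2 + 2)) = (Real.exp 1)⁻¹ * Real.exp (-(u ^ 2 + 1)) := by
          rw [← Real.exp_neg, ← Real.exp_add]
          congr 1
          ring
      _ ≤ _ := by
          gcongr
          nlinarith [sq_nonneg (u - 1)]
  have h3 : (gaussianReal 0 1).real (Set.Iio u) = 1 - (gaussianReal 0 1).real (Set.Ici u) := by
    rw [← Set.compl_Ici, probReal_compl_eq_one_sub measurableSet_Ici]
  rw [show -((n : ℝ) * Real.exp (-(u ^ 2 + 2))) = n * (-Real.exp (-(u ^ 2 + 2))) by ring,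
    Real.exp_nat_mul]
  refine pow_le_pow_left₀ measureReal_nonneg ?_ n
  rw [h3]
  linarith [Real.add_one_le_exp (-Real.exp (-(u ^ 2 + 2)))]

/-- The expected maximum of fractional Brownian motion on `[0, 1]` is at least of order
`1 / √H`. -/
lemma IsFractionalBrownianMotion.inv_sqrt_le_integral_sup (hH : 0 < H)
    (hB : IsFractionalBrownianMotion H 1 U P)
    (hc : ∀ ω, Continuous fun t => U t ω) (h0 : ∀ ω, U 0 ω = 0)
    (hint : Integrable (supOnUnitInterval U) P) :
    1 / 60 * √(1 / H) ≤ ∫ ω, supOnUnitInterval U ω ∂P := by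
  have he1 : Real.exp 1 < 2.7182818286 := Real.exp_one_lt_d9
  rcases le_total H (1 / 4) with hH4 | hH4
  · have hH4' : 4 ≤ 1 / H := by rw [le_div_iff₀ hH]; linarith
    -- The largest order of n for which n^(-2H) ≥ e^(-2) still holds; then log n is about 1/H.
    set n : ℕ := ⌊Real.exp (1 / H)⌋₊ with hn
    have hexp : 2 ≤ Real.exp (1 / H) := by linarith [Real.add_one_le_exp (1 / H)]
    have hnle : (n : ℝ) ≤ Real.exp (1 / H) := Nat.floor_le (Real.exp_pos _).le
    have hnge : Real.exp (1 / H) / 2 ≤ n := by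
      have := Nat.lt_floor_add_one (Real.exp (1 / H))
      rw [← hn] at this
      linarith
    have hn1 : (1 : ℝ) ≤ n := by linarith
    have hn0 : n ≠ 0 := by
      rintro h
      rw [h] at hn1
      norm_num at hn1
    -- Half of √(1/H) makes u² = 1/(4H), so n e^(-(u² + 2)) ≥ 1 already from 1/H ≥ 4, and level u is
    -- exceeded with probability at least 1/2.
    set u : ℝ := √(1 / H) / 2 with hu
    have hu0 : 0 ≤ u := by positivity
    have hu2 : u ^ 2 = 1 / H / 4 := by
      rw [hu, div_pow, Real.sq_sqrt (by positivity)]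
      norm_num
    have key := hB.le_integral_sup hc h0 hint hn0 (fun i => ((i + 1 : ℕ) : ℝ) / n)
      (fun i => ⟨by positivity, by
        rw [div_le_one (by positivity)]
        exact_mod_cast i.is_lt⟩) (by positivity) (posSemidef_covariance_grid_sub hH hH4 hn0) u
    refine le_trans ?_ key
    have hpow : (gaussianReal 0 1).real (Set.Iio u) ^ n ≤ 1 / 2 := by
      refine (gaussianReal_Iio_pow_le n hu0).trans ?_
      have : (1 : ℝ) ≤ n * Real.exp (-(u ^ 2 + 2)) := by
        calc (1 : ℝ) ≤ Real.exp (1 / H - 1 + -(u ^ 2 + 2)) := by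
              rw [Real.one_le_exp_iff, hu2]
              linarith
          _ = Real.exp (1 / H) * Real.exp (-1) * Real.exp (-(u ^ 2 + 2)) := by
              rw [← Real.exp_add, ← Real.exp_add]
              congr 1
          _ ≤ Real.exp (1 / H) / 2 * Real.exp (-(u ^ 2 + 2)) := by
              have : Real.exp (-1) ≤ 1 / 2 := by
                rw [Real.exp_neg, one_div]
                exact inv_anti₀ (by norm_num) (by linarith [Real.exp_one_gt_d9])
              have := mul_le_mul_of_nonneg_left this (Real.exp_pos (1 / H)).le
              gcongr
              linarith
          _ ≤ _ := by gcongr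
      calc Real.exp (-(n * Real.exp (-(u ^ 2 + 2)))) ≤ Real.exp (-1) := by gcongr
        _ ≤ 1 / 2 := by
            rw [Real.exp_neg, one_div]
            exact inv_anti₀ (by norm_num) (by linarith [Real.exp_one_gt_d9])
    have hκ : 1 / 6 ≤ √((n : ℝ) ^ (-(2 * H)) / 4) := by
      apply Real.le_sqrt_of_sq_le
      have : Real.exp (-2) ≤ (n : ℝ) ^ (-(2 * H)) := by
        calc Real.exp (-2) = Real.exp (1 / H) ^ (-(2 * H)) := by
              rw [← Real.exp_mul]
              congr 1
              field_simp
          _ ≤ _ := Real.rpow_le_rpow_of_nonpos (by positivity) hnle (by linarith)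
      have h2 : (1 / 9 : ℝ) ≤ Real.exp (-2) := by
        rw [Real.exp_neg, one_div]
        refine inv_anti₀ (Real.exp_pos _) ?_
        rw [show (2 : ℝ) = 1 + 1 by norm_num, Real.exp_add]
        nlinarith [Real.exp_pos 1]
      linarith
    calc 1 / 60 * √(1 / H) ≤ 1 / 6 * u * (1 / 2) := by
          rw [hu]
          linarith [Real.sqrt_nonneg (1 / H)]
      _ ≤ _ := by
          gcongr
          linarith
  -- For H ≥ 1/4 one has √(1/H) ≤ 2, so the standard Gaussian value at time 1, with level u = 1, is
  -- enough.
  · have hPSD : (Matrix.of (fun i j : Fin 1 => (1 / 2) * (|(1 : ℝ)| ^ (2 * H) + |(1 : ℝ)| ^ (2 * H)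
        - |(1 : ℝ) - 1| ^ (2 * H))) - (1 : ℝ) • (1 : Matrix (Fin 1) (Fin 1) ℝ)).PosSemidef := by
      have hp : 2 * H ≠ 0 := by positivity
      convert! Matrix.PosSemidef.zero
      ext i j
      fin_cases i
      fin_cases j
      norm_num [Real.zero_rpow hp]
    have key := hB.le_integral_sup hc h0 hint one_ne_zero (fun _ => 1)
      (fun _ => ⟨zero_le_one, le_rfl⟩) zero_le_one hPSD 1
    refine le_trans ?_ key
    have h1 : √(1 / H) ≤ 2 := by
      rw [Real.sqrt_le_left (by norm_num), div_le_iff₀ hH]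
      linarith
    have h2 := gaussianReal_Iio_pow_le 1 (zero_le_one (α := ℝ))
    have h3 : (1 / 27 : ℝ) ≤ Real.exp (-3) := by
      rw [Real.exp_neg, one_div]
      refine inv_anti₀ (Real.exp_pos _) ?_
      rw [show (3 : ℝ) = 1 + 1 + 1 by norm_num, Real.exp_add, Real.exp_add]
      have := Real.exp_pos 1
      have : Real.exp 1 * Real.exp 1 ≤ 9 := by nlinarith
      nlinarith
    have h4 : Real.exp (-((1 : ℕ) * Real.exp (-((1 : ℝ) ^ 2 + 2)))) ≤ 29 / 30 := by
      rw [Real.exp_neg]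
      rw [inv_le_comm₀ (Real.exp_pos _) (by norm_num)]
      have := Real.add_one_le_exp (((1 : ℕ) : ℝ) * Real.exp (-((1 : ℝ) ^ 2 + 2)))
      norm_num at this ⊢
      linarith
    have h5 := h2.trans h4
    rw [Real.sqrt_one, one_mul, one_mul]
    linarith

end lowerBound

/-! ### Chaining and an integrable bound on the paths. -/

/-- Dyadic chaining. -/
lemma enorm_le_tsum_of_dyadic_increments {f : ℝ → ℝ} (hf : Continuous f) (h0 : f 0 = 0)
    {D : ℕ → ENNReal} (hD : ∀ n k : ℕ, k < 2 ^ n →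
      ‖f (((k + 1 : ℕ) : ℝ) / 2 ^ n) - f ((k : ℝ) / 2 ^ n)‖ₑ ≤ D n)
    {t : ℝ} (ht : t ∈ Set.Icc (0 : ℝ) 1) : ‖f t‖ₑ ≤ ∑' n, D n := by
  have hle : ∀ n : ℕ, ⌊t * 2 ^ n⌋₊ ≤ 2 ^ n := by
    intro n
    refine Nat.floor_le_of_le ?_
    push_cast
    have : (0 : ℝ) < 2 ^ n := by positivity
    nlinarith [ht.2]
  have hsum : ∀ n : ℕ, ‖f ((⌊t * 2 ^ n⌋₊ : ℝ) / 2 ^ n)‖ₑ ≤ ∑ i ∈ Finset.range (n + 1), D i := by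
    intro n
    induction n with
    | zero =>
      have h1 := hle 0
      simp only [pow_zero, mul_one, div_one, zero_add, Finset.sum_range_one] at h1 ⊢
      interval_cases h : ⌊t⌋₊
      · simp [h0]
      · have := hD 0 0 (by norm_num)
        simpa [h0] using this
    | succ n ih =>
      rw [Finset.sum_range_succ]
      set k := ⌊t * 2 ^ n⌋₊ with hk
      have hk' : (k : ℝ) / 2 ^ n = ((2 * k : ℕ) : ℝ) / 2 ^ (n + 1) := by
        push_cast
        rw [pow_succ]
        field_simp
      have ht0 : 0 ≤ t * 2 ^ n := mul_nonneg ht.1 (by positivity)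
      have hkl : (k : ℝ) ≤ t * 2 ^ n := Nat.floor_le ht0
      have hku : t * 2 ^ n < k + 1 := Nat.lt_floor_add_one _
      -- The next binary digit of t: the approximation either stays put or moves by one increment of
      -- level n + 1.
      have hcase : ⌊t * 2 ^ (n + 1)⌋₊ = 2 * k ∨ ⌊t * 2 ^ (n + 1)⌋₊ = 2 * k + 1 := by
        have e : t * 2 ^ (n + 1) = 2 * (t * 2 ^ n) := by ring
        rw [e]
        have h1 : 2 * k ≤ ⌊2 * (t * 2 ^ n)⌋₊ := Nat.le_floor (by push_cast; linarith)
        have h2 : ⌊2 * (t * 2 ^ n)⌋₊ < 2 * k + 2 :=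
          (Nat.floor_lt (by linarith)).2 (by push_cast; linarith)
        omega
      rcases hcase with h | h
      · rw [h, ← hk']
        exact ih.trans le_self_add
      · have hlt : 2 * k < 2 ^ (n + 1) := by
          have := hle (n + 1)
          omega
        have := hD (n + 1) (2 * k) hlt
        rw [h]
        rw [hk'] at ih
        calc ‖f (((2 * k + 1 : ℕ) : ℝ) / 2 ^ (n + 1))‖ₑ
            = ‖f (((2 * k : ℕ) : ℝ) / 2 ^ (n + 1)) + (f (((2 * k + 1 : ℕ) : ℝ) / 2 ^ (n + 1))
              - f (((2 * k : ℕ) : ℝ) / 2 ^ (n + 1)))‖ₑ := by rw [add_sub_cancel]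
          _ ≤ _ := enorm_add_le _ _
          _ ≤ _ := add_le_add ih this
  have hlim : Filter.Tendsto (fun n : ℕ => (⌊t * 2 ^ n⌋₊ : ℝ) / 2 ^ n) Filter.atTop (nhds t) :=
    (tendsto_nat_floor_mul_div_atTop ht.1).comp (tendsto_pow_atTop_atTop_of_one_lt one_lt_two)
  refine le_of_tendsto (((continuous_enorm.comp hf).tendsto t).comp hlim) (.of_forall fun n => ?_)
  exact (hsum n).trans (ENNReal.sum_le_tsum _)

/-- Replaces a maximum over increments by ε plus a sum of p-th powers, whose expectation is
explicit; no p-th root is needed. -/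
lemma enorm_le_add_mul_pow {p : ℕ} (hp : p ≠ 0) {ε : ℝ} (hε : 0 < ε) (hε1 : ε ≤ 1) (x : ℝ) :
    ‖x‖ₑ ≤ ENNReal.ofReal ε + ENNReal.ofReal ((ε⁻¹) ^ p) * ‖x‖ₑ ^ p := by
  rw [← ofReal_norm, ← ENNReal.ofReal_pow (norm_nonneg x), ← ENNReal.ofReal_mul (by positivity),
    ← ENNReal.ofReal_add hε.le (by positivity), ← mul_pow]
  apply ENNReal.ofReal_le_ofReal
  rcases le_total ‖x‖ ε with h | h
  · have : 0 ≤ (ε⁻¹ * ‖x‖) ^ p := by positivity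
    linarith
  · have h1 : 1 ≤ ε⁻¹ * ‖x‖ := by rwa [inv_mul_eq_div, one_le_div hε]
    have h2 : ‖x‖ ≤ ε⁻¹ * ‖x‖ := le_mul_of_one_le_left (norm_nonneg x) ((one_le_inv₀ hε).2 hε1)
    have := le_self_pow₀ h1 hp
    linarith

section

variable {Ω : Type*} [MeasurableSpace Ω] {P : Measure Ω} {H : ℝ} {U : ℝ → Ω → ℝ}

lemma IsFractionalBrownianMotion.lintegral_increment_pow (hH : 0 < H)
    (hB : IsFractionalBrownianMotion H 1 U P) {s t : ℝ} (hs : s ∈ Set.Icc (0 : ℝ) 1)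
    (ht : t ∈ Set.Icc (0 : ℝ) 1) (p : ℕ) :
    ∫⁻ ω, ‖U t ω - U s ω‖ₑ ^ p ∂P
      = ENNReal.ofReal ((|t - s| ^ H) ^ p) * ∫⁻ x, ‖x‖ₑ ^ p ∂(gaussianReal 0 1) := by
  have hg : HasGaussianLaw (fun ω => U t ω - U s ω) P :=
    hB.isGaussianProcess.hasGaussianLaw_fun_sub (s := ⟨t, ht⟩) (t := ⟨s, hs⟩)
  have hmt : MemLp (U t) 2 P := (hB.isGaussianProcess.hasGaussianLaw_eval ⟨t, ht⟩).memLp_two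
  have hms : MemLp (U s) 2 P := (hB.isGaussianProcess.hasGaussianLaw_eval ⟨s, hs⟩).memLp_two
  have hP := hg.isProbabilityMeasure
  have hmean : ∫ ω, (U t ω - U s ω) ∂P = 0 := by
    rw [integral_sub (hmt.integrable (by norm_num)) (hms.integrable (by norm_num)),
      hB.centered t ht, hB.centered s hs, sub_zero]
  have hvar : Var[fun ω => U t ω - U s ω; P] = (|t - s| ^ H) ^ 2 := by
    have htt : Integrable (fun ω => U t ω * U t ω) P := hmt.integrable_mul hmt
    have hts : Integrable (fun ω => U t ω * U s ω) P := hmt.integrable_mul hms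
    have hss : Integrable (fun ω => U s ω * U s ω) P := hms.integrable_mul hms
    have hp : 2 * H ≠ 0 := by positivity
    rw [variance_of_integral_eq_zero hg.aemeasurable hmean]
    have e : ∀ ω, (U t ω - U s ω) ^ 2 = U t ω * U t ω - 2 * (U t ω * U s ω) + U s ω * U s ω :=
      fun ω => by ring
    simp_rw [e]
    rw [integral_add (f := fun ω => U t ω * U t ω - 2 * (U t ω * U s ω))
      (htt.sub (hts.const_mul 2)) hss, integral_sub htt (hts.const_mul 2),
      integral_const_mul, hB.covariance t ht t ht, hB.covariance t ht s hs,
      hB.covariance s hs s hs, ← Real.rpow_natCast, ← Real.rpow_mul (abs_nonneg _)]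
    simp only [sub_self, abs_zero, Real.zero_rpow hp]
    rw [mul_comm H]
    push_cast
    ring
  have hmap : P.map (fun ω => U t ω - U s ω)
      = (gaussianReal 0 1).map (fun x => |t - s| ^ H * x) := by
    rw [hg.map_eq_gaussianReal, hmean, hvar, gaussianReal_map_const_mul, mul_zero, mul_one]
    congr 1
    ext
    simp [sq_nonneg]
  have h1 := lintegral_map' (f := fun x : ℝ => ‖x‖ₑ ^ p) (by fun_prop) hg.aemeasurable
  rw [← h1, hmap, lintegral_map (by fun_prop) (by fun_prop), ← lintegral_const_mul _ (by fun_prop)]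
  congr 1
  ext x
  rw [enorm_mul, mul_pow, ← ofReal_norm (|t - s| ^ H), ← ENNReal.ofReal_pow (norm_nonneg _),
    Real.norm_of_nonneg (by positivity)]

lemma lintegral_enorm_pow_gaussianReal_lt_top (p : ℕ) :
    ∫⁻ x, ‖x‖ₑ ^ p ∂(gaussianReal 0 1) < ⊤ := by
  rcases Nat.eq_zero_or_pos p with rfl | hp
  · simp
  · have h := (memLp_id_gaussianReal' (μ := 0) (v := 1) p (by simp)).2
    have h2 := lintegral_rpow_enorm_lt_top_of_eLpNorm_lt_top (by exact_mod_cast hp.ne')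
      (by simp) h
    simpa using h2

/-- The paths of fractional Brownian motion have an integrable bound. -/
lemma IsFractionalBrownianMotion.exists_integrable_bound (hH : 0 < H)
    (hB : IsFractionalBrownianMotion H 1 U P)
    (hc : ∀ ω, Continuous fun t => U t ω) (hm : ∀ t, Measurable (U t)) (h0 : ∀ ω, U 0 ω = 0) :
    ∃ Z : Ω → ℝ, Integrable Z P ∧ ∀ᵐ ω ∂P, ∀ t ∈ Set.Icc (0 : ℝ) 1, |U t ω| ≤ Z ω := by
  have hP := hB.isGaussianProcess.isProbabilityMeasure
  -- A level-n increment has standard deviation 2^(-nH) = r^(2n). Measured against the threshold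
  -- r^n, its p-th moment is r^(np) times a constant, and r^p < 1/4 beats the 2^n increments of that
  -- level.
  set r : ℝ := (1 / 2) ^ (H / 2) with hr
  have hr0 : 0 < r := by positivity
  have hr1 : r < 1 := Real.rpow_lt_one (by norm_num) (by norm_num) (by positivity)
  obtain ⟨p, hp⟩ := exists_pow_lt_of_lt_one (by norm_num : (0 : ℝ) < 1 / 4) hr1
  have hp0 : p ≠ 0 := by
    rintro rfl
    norm_num at hp
  set M := ∫⁻ x, ‖x‖ₑ ^ p ∂(gaussianReal 0 1) with hM
  let D : ℕ → Ω → ENNReal := fun n ω => ENNReal.ofReal (r ^ n) +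
    ∑ k ∈ Finset.range (2 ^ n), ENNReal.ofReal (((r ^ n)⁻¹) ^ p) *
      ‖U (((k + 1 : ℕ) : ℝ) / 2 ^ n) ω - U ((k : ℝ) / 2 ^ n) ω‖ₑ ^ p
  have hDm : ∀ n, Measurable (D n) := by
    intro n
    have : ∀ k : ℕ, Measurable fun ω =>
      U (((k + 1 : ℕ) : ℝ) / 2 ^ n) ω - U ((k : ℝ) / 2 ^ n) ω := fun k => (hm _).sub (hm _)
    exact measurable_const.add (Finset.measurable_fun_sum (Finset.range (2 ^ n)) fun k _ =>
      ((this k).enorm.pow_const p).const_mul _)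
  have hDint : ∀ n, ∫⁻ ω, D n ω ∂P ≤ ENNReal.ofReal (r ^ n)
      + ENNReal.ofReal ((1 / 2) ^ n) * M := by
    intro n
    have : ∀ k : ℕ, Measurable fun ω =>
      U (((k + 1 : ℕ) : ℝ) / 2 ^ n) ω - U ((k : ℝ) / 2 ^ n) ω := fun k => (hm _).sub (hm _)
    rw [lintegral_add_left measurable_const, lintegral_const, measure_univ, mul_one,
      lintegral_finsetSum _ fun k _ => ((this k).enorm.pow_const p).const_mul _]
    gcongr
    have hterm : ∀ k ∈ Finset.range (2 ^ n), ∫⁻ ω, ENNReal.ofReal (((r ^ n)⁻¹) ^ p) *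
        ‖U (((k + 1 : ℕ) : ℝ) / 2 ^ n) ω - U ((k : ℝ) / 2 ^ n) ω‖ₑ ^ p ∂P
        = ENNReal.ofReal ((r ^ p) ^ n) * M := by
      intro k hk
      rw [Finset.mem_range] at hk
      have hk' : (k : ℝ) + 1 ≤ 2 ^ n := by exact_mod_cast hk
      have h2n : (0 : ℝ) < 2 ^ n := by positivity
      rw [lintegral_const_mul _ ((this k).enorm.pow_const p), hB.lintegral_increment_pow hH
        ⟨by positivity, by rw [div_le_one h2n]; linarith⟩
        ⟨by positivity, by rw [div_le_one h2n]; push_cast; linarith⟩ p, ← mul_assoc,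
        ← ENNReal.ofReal_mul (by positivity), ← mul_pow]
      congr 2
      rw [← pow_mul, mul_comm p n, pow_mul]
      congr 1
      have e1 : ((k + 1 : ℕ) : ℝ) / 2 ^ n - (k : ℝ) / 2 ^ n = (1 / 2) ^ n := by
        push_cast
        rw [← sub_div, add_sub_cancel_left, one_div_pow]
      have e2 : |((k + 1 : ℕ) : ℝ) / 2 ^ n - (k : ℝ) / 2 ^ n| ^ H = r ^ n * r ^ n := by
        rw [e1, abs_of_pos (by positivity), ← mul_pow, hr, ← Real.rpow_add (by norm_num),
          add_halves, ← Real.rpow_natCast, ← Real.rpow_mul (by norm_num), ← Real.rpow_natCast,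
          ← Real.rpow_mul (by norm_num), mul_comm]
      rw [e2]
      field_simp
    rw [Finset.sum_congr rfl hterm, Finset.sum_const, Finset.card_range, nsmul_eq_mul, ← mul_assoc]
    gcongr
    rw [← ENNReal.ofReal_natCast, ← ENNReal.ofReal_mul (by positivity)]
    apply ENNReal.ofReal_le_ofReal
    push_cast
    rw [← mul_pow]
    exact pow_le_pow_left₀ (by positivity) (by linarith) n
  have hZ : ∫⁻ ω, ∑' n, D n ω ∂P ≠ ⊤ := by
    rw [lintegral_tsum fun n => (hDm n).aemeasurable]
    refine ne_top_of_le_ne_top ?_ (ENNReal.tsum_le_tsum hDint)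
    rw [ENNReal.tsum_add, ENNReal.tsum_mul_right]
    refine ENNReal.add_ne_top.2 ⟨?_, ENNReal.mul_ne_top ?_
      (lintegral_enorm_pow_gaussianReal_lt_top p).ne⟩
    · exact (summable_geometric_of_lt_one hr0.le hr1).tsum_ofReal_ne_top
    · exact (summable_geometric_of_lt_one (by norm_num) (by norm_num)).tsum_ofReal_ne_top
  have hZm : Measurable fun ω => ∑' n, D n ω := Measurable.tsum hDm
  refine ⟨fun ω => (∑' n, D n ω).toReal, integrable_toReal_of_lintegral_ne_top hZm.aemeasurable hZ,
    ?_⟩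
  filter_upwards [ae_lt_top hZm hZ] with ω hω t ht
  have h := enorm_le_tsum_of_dyadic_increments (hc ω) (h0 ω) (D := fun n => D n ω)
    (fun n k hk => ?_) ht
  · have := ENNReal.toReal_mono hω.ne h
    rwa [toReal_enorm, Real.norm_eq_abs] at this
  · refine (enorm_le_add_mul_pow hp0 (pow_pos hr0 n) (pow_le_one₀ hr0.le hr1.le) _).trans ?_
    simp only [D]
    gcongr
    exact Finset.single_le_sum (f := fun k : ℕ => ENNReal.ofReal (((r ^ n)⁻¹) ^ p) *
      ‖U (((k + 1 : ℕ) : ℝ) / 2 ^ n) ω - U ((k : ℝ) / 2 ^ n) ω‖ₑ ^ p) (fun _ _ => zero_le)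
      (Finset.mem_range.2 hk)

end

/-! ### The linear integral equation, path by path. -/

/-- The solution of `v t = -β * ∫ s in 0..t, v s + u t`. -/
noncomputable def linearResponse (β : ℝ) (u : ℝ → ℝ) (t : ℝ) : ℝ :=
  u t - β * (Real.exp (-β * t) * ∫ s in (0 : ℝ)..t, Real.exp (β * s) * u s)

section linearResponse

variable {β : ℝ} {u : ℝ → ℝ}

lemma linearResponse_zero (h0 : u 0 = 0) : linearResponse β u 0 = 0 := by
  simp [linearResponse, h0]

lemma continuous_linearResponse (hu : Continuous u) : Continuous (linearResponse β u) := by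
  have : Continuous fun t => ∫ s in (0 : ℝ)..t, Real.exp (β * s) * u s :=
    intervalIntegral.continuous_primitive (fun a b => (by fun_prop :
      Continuous fun s => Real.exp (β * s) * u s).intervalIntegrable a b) 0
  unfold linearResponse
  fun_prop

/-- The right side vanishes at 0 and its derivative is `linearResponse β u`. -/
lemma integral_linearResponse (hu : Continuous u) (t : ℝ) :
    ∫ s in (0 : ℝ)..t, linearResponse β u s
      = Real.exp (-β * t) * ∫ s in (0 : ℝ)..t, Real.exp (β * s) * u s := by
  have hd : ∀ t, HasDerivAt (fun t => Real.exp (-β * t) *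
      ∫ s in (0 : ℝ)..t, Real.exp (β * s) * u s) (linearResponse β u t) t := by
    intro t
    have h1 : HasDerivAt (fun t => ∫ s in (0 : ℝ)..t, Real.exp (β * s) * u s)
        (Real.exp (β * t) * u t) t :=
      (by fun_prop : Continuous fun s => Real.exp (β * s) * u s).integral_hasStrictDerivAt
        0 t |>.hasDerivAt
    have h2 : HasDerivAt (fun t => Real.exp (-β * t)) (Real.exp (-β * t) * (-β)) t := by
      simpa using ((hasDerivAt_id t).const_mul (-β)).exp
    convert! h2.mul h1 using 1
    have : Real.exp (-β * t) * Real.exp (β * t) = 1 := by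
      rw [← Real.exp_add]
      simp
    unfold linearResponse
    linear_combination (-u t) * this
  rw [intervalIntegral.integral_eq_sub_of_hasDerivAt (fun s _ => hd s)
    ((continuous_linearResponse hu).intervalIntegrable _ _)]
  simp

lemma linearResponse_eq (hu : Continuous u) (t : ℝ) :
    linearResponse β u t = -β * (∫ s in (0 : ℝ)..t, linearResponse β u s) + u t := by
  rw [integral_linearResponse hu, linearResponse]
  ring

lemma abs_linearResponse_le (z : ℝ) (hz : ∀ t ∈ Set.Icc (0 : ℝ) 1, |u t| ≤ z) {t : ℝ}
    (ht : t ∈ Set.Icc (0 : ℝ) 1) :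
    |linearResponse β u t| ≤ (1 + |β| * (Real.exp |β| * Real.exp |β|)) * z := by
  have hz0 : 0 ≤ z := (abs_nonneg _).trans (hz t ht)
  have hexp : ∀ s ∈ Set.Icc (0 : ℝ) 1, ∀ b : ℝ, |b| = |β| → Real.exp (b * s) ≤ Real.exp |β| := by
    intro s hs b hb
    gcongr
    rw [← hb]
    calc b * s ≤ |b * s| := le_abs_self _
      _ = |b| * s := by rw [abs_mul, abs_of_nonneg hs.1]
      _ ≤ |b| * 1 := by gcongr; exact hs.2
      _ = |b| := mul_one _
  have hint : |∫ s in (0 : ℝ)..t, Real.exp (β * s) * u s| ≤ Real.exp |β| * z := by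
    have := intervalIntegral.norm_integral_le_of_norm_le_const (a := 0) (b := t)
      (f := fun s => Real.exp (β * s) * u s) (C := Real.exp |β| * z) fun s hs => by
        rw [Set.uIoc_of_le ht.1] at hs
        have hs' : s ∈ Set.Icc (0 : ℝ) 1 := ⟨hs.1.le, hs.2.trans ht.2⟩
        rw [norm_mul, Real.norm_of_nonneg (Real.exp_pos _).le, Real.norm_eq_abs]
        exact mul_le_mul (hexp s hs' β rfl) (hz s hs') (abs_nonneg _) (Real.exp_pos _).le
    rw [Real.norm_eq_abs, sub_zero, abs_of_nonneg ht.1] at this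
    refine this.trans (mul_le_of_le_one_right (by positivity) ht.2)
  calc |linearResponse β u t|
      ≤ |u t| + |β * (Real.exp (-β * t) * ∫ s in (0 : ℝ)..t, Real.exp (β * s) * u s)| :=
        abs_sub _ _
    _ = |u t| + |β| * (Real.exp (-β * t) * |∫ s in (0 : ℝ)..t, Real.exp (β * s) * u s|) := by
        rw [abs_mul, abs_mul, abs_of_pos (Real.exp_pos _)]
    _ ≤ z + |β| * (Real.exp |β| * (Real.exp |β| * z)) := by
        gcongr
        · exact hz t ht
        · exact Real.exp_le_exp.1 (hexp t ht (-β) (abs_neg β))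
    _ = _ := by ring

end linearResponse

/-- A continuous solution of the linear homogeneous integral equation vanishes. -/
lemma eq_zero_of_eq_integral {β : ℝ} {f : ℝ → ℝ} (hf : ContinuousOn f (Set.Icc 0 1))
    (h : ∀ t ∈ Set.Icc (0 : ℝ) 1, f t = -β * ∫ s in (0 : ℝ)..t, f s) :
    ∀ t ∈ Set.Icc (0 : ℝ) 1, f t = 0 := by
  let g : ℝ → ℝ := Set.IccExtend zero_le_one ((Set.Icc (0 : ℝ) 1).domRestrict f)
  have hg : Continuous g := hf.domRestrict.Icc_extend'
  have hgf : ∀ t ∈ Set.Icc (0 : ℝ) 1, g t = f t := fun t ht => Set.IccExtend_of_mem _ _ ht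
  have hgi : ∀ t ∈ Set.Icc (0 : ℝ) 1, g t = -β * ∫ s in (0 : ℝ)..t, g s := by
    intro t ht
    rw [hgf t ht, h t ht]
    congr 1
    refine intervalIntegral.integral_congr fun s hs => ?_
    rw [Set.uIcc_of_le ht.1] at hs
    exact (hgf s ⟨hs.1, hs.2.trans ht.2⟩).symm
  have hd : ∀ t, HasDerivAt (fun t => ∫ s in (0 : ℝ)..t, g s) (g t) t := fun t =>
    (hg.integral_hasStrictDerivAt 0 t).hasDerivAt
  -- Grönwall is applied to the primitive, which is differentiable, and not to f, which is only
  -- continuous.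
  have hb := norm_le_gronwallBound_of_norm_deriv_right_le (f := fun t => ∫ s in (0 : ℝ)..t, g s)
    (f' := g) (δ := 0) (K := |β|) (ε := 0) (a := 0) (b := 1)
    (fun t _ => (hd t).continuousAt.continuousWithinAt) (fun t _ => (hd t).hasDerivWithinAt)
    (by simp) fun t ht => by
      rw [hgi t ⟨ht.1, ht.2.le⟩, norm_mul, norm_neg, Real.norm_eq_abs β, add_zero]
  intro t ht
  have := hb t ht
  rw [gronwallBound_ε0, zero_mul, norm_le_zero_iff] at this
  rw [← hgf t ht, hgi t ht, this, mul_zero]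

section

variable {Ω : Type*} [MeasurableSpace Ω] {P : Measure Ω} {β σ : ℝ} {B U X : ℝ → Ω → ℝ}

/-- The difference of the two sides solves the homogeneous equation. Taking σ = 1 also identifies
every unit-noise solution. -/
lemma IsFractionalOU.ae_eq_mul_linearResponse (hX : IsFractionalOU β σ 1 B X P)
    (hc : ∀ ω, Continuous fun t => U t ω) (h0 : ∀ ω, U 0 ω = 0)
    (hBU : ∀ᵐ ω ∂P, ∀ t ∈ Set.Icc (0 : ℝ) 1, B t ω = U t ω) :
    ∀ᵐ ω ∂P, ∀ t ∈ Set.Icc (0 : ℝ) 1, X t ω = σ * linearResponse β (fun s => U s ω) t := by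
  filter_upwards [hX.initial, hX.continuous_paths, hX.equation, hBU] with ω hi hcX he hb t ht
  set v := linearResponse β (fun s => U s ω) with hv
  have hvc : Continuous v := continuous_linearResponse (hc ω)
  have key := eq_zero_of_eq_integral (β := β) (f := fun t => X t ω - σ * v t)
    (hcX.sub (hvc.const_mul σ).continuousOn) (fun t ht => ?_) t ht
  · linarith
  · have hXi : IntervalIntegrable (fun s => X s ω) volume 0 t := by
      refine ContinuousOn.intervalIntegrable ?_
      rw [Set.uIcc_of_le ht.1]
      exact hcX.mono (Set.Icc_subset_Icc le_rfl ht.2)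
    rw [intervalIntegral.integral_sub hXi ((hvc.const_mul σ).intervalIntegrable _ _),
      intervalIntegral.integral_const_mul, he t ht, hi, hb t ht, hb 0 (by simp), h0, hv,
      linearResponse_eq (hc ω), ← hv, intervalIntegral.integral_const_mul]
    ring

lemma isFractionalOU_linearResponse (hc : ∀ ω, Continuous fun t => U t ω) (h0 : ∀ ω, U 0 ω = 0)
    (hBU : ∀ᵐ ω ∂P, ∀ t ∈ Set.Icc (0 : ℝ) 1, B t ω = U t ω) :
    IsFractionalOU β 1 1 B (fun t ω => linearResponse β (fun s => U s ω) t) P where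
  initial := .of_forall fun ω => linearResponse_zero (h0 ω)
  continuous_paths := .of_forall fun ω => (continuous_linearResponse (hc ω)).continuousOn
  equation := by
    filter_upwards [hBU] with ω hb t ht
    rw [linearResponse_zero (h0 ω), hb t ht, hb 0 (by simp), h0, linearResponse_eq (hc ω),
      intervalIntegral.integral_const_mul]
    ring

end

/-! ### Expectations and the comparison of the two suprema. -/

section

variable {Ω : Type*} [MeasurableSpace Ω] {P : Measure Ω} {V : ℝ → Ω → ℝ} {Z : Ω → ℝ}

lemma integrable_uncurry_of_abs_le [SFinite P] (hc : ∀ ω, Continuous fun t => V t ω)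
    (hm : ∀ t, Measurable (V t)) (hZ : Integrable Z P)
    (hVZ : ∀ᵐ ω ∂P, ∀ t ∈ Set.Icc (0 : ℝ) 1, |V t ω| ≤ Z ω) {t : ℝ} (ht : t ∈ Set.Icc (0 : ℝ) 1) :
    Integrable (Function.uncurry V) ((volume.restrict (Set.uIoc 0 t)).prod P) := by
  have hmeas := measurable_uncurry_of_continuous_of_measurable (u := V) hc hm
  obtain ⟨Z', hZm, hZZ'⟩ := hZ.aestronglyMeasurable
  have hZ' := hZ.congr hZZ'
  have hfin : IsFiniteMeasure ((volume : Measure ℝ).restrict (Set.uIoc 0 t)) :=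
    ⟨by simp [Set.uIoc_of_le ht.1]⟩
  refine (hZ'.comp_snd (volume.restrict (Set.uIoc 0 t))).mono' hmeas.aestronglyMeasurable ?_
  refine (Measure.ae_prod_iff_ae_ae (measurableSet_le hmeas.norm
    (hZm.measurable.comp measurable_snd))).2 ?_
  filter_upwards [ae_restrict_mem measurableSet_uIoc] with s hs
  rw [Set.uIoc_of_le ht.1] at hs
  filter_upwards [hVZ, hZZ'] with ω h1 h2
  rw [Function.comp_apply, ← h2]
  exact h1 s ⟨hs.1.le, hs.2.trans ht.2⟩

lemma measurable_intervalIntegral (hc : ∀ ω, Continuous fun t => V t ω)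
    (hm : ∀ t, Measurable (V t)) (a b : ℝ) : Measurable fun ω => ∫ s in a..b, V s ω := by
  have hmeas := (measurable_uncurry_of_continuous_of_measurable (u := V) hc hm).comp
    (measurable_swap (α := Ω) (β := ℝ))
  unfold intervalIntegral
  exact (hmeas.stronglyMeasurable.integral_prod_right' (ν := volume.restrict (Set.Ioc a b))).measurable.sub
    (hmeas.stronglyMeasurable.integral_prod_right' (ν := volume.restrict (Set.Ioc b a))).measurable

lemma integrable_intervalIntegral_of_abs_le [SFinite P] (hc : ∀ ω, Continuous fun t => V t ω)
    (hm : ∀ t, Measurable (V t)) (hZ : Integrable Z P)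
    (hVZ : ∀ᵐ ω ∂P, ∀ t ∈ Set.Icc (0 : ℝ) 1, |V t ω| ≤ Z ω) {t : ℝ} (ht : t ∈ Set.Icc (0 : ℝ) 1) :
    Integrable (fun ω => ∫ s in (0 : ℝ)..t, V s ω) P := by
  refine hZ.mono' (measurable_intervalIntegral hc hm 0 t).aestronglyMeasurable ?_
  filter_upwards [hVZ] with ω hω
  have := intervalIntegral.norm_integral_le_of_norm_le_const (a := 0) (b := t)
    (f := fun s => V s ω) (C := Z ω) fun s hs => by
      rw [Set.uIoc_of_le ht.1] at hs
      exact hω s ⟨hs.1.le, hs.2.trans ht.2⟩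
  rw [sub_zero, abs_of_nonneg ht.1] at this
  exact this.trans (mul_le_of_le_one_right ((abs_nonneg _).trans (hω t ht)) ht.2)

lemma integrable_of_abs_le (hm : ∀ t, Measurable (V t)) (hZ : Integrable Z P)
    (hVZ : ∀ᵐ ω ∂P, ∀ t ∈ Set.Icc (0 : ℝ) 1, |V t ω| ≤ Z ω) {t : ℝ} (ht : t ∈ Set.Icc (0 : ℝ) 1) :
    Integrable (V t) P :=
  hZ.mono' (hm t).aestronglyMeasurable (by filter_upwards [hVZ] with ω hω using hω t ht)

lemma integrable_supOnUnitInterval_of_abs_le (hc : ∀ ω, Continuous fun t => V t ω)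
    (hm : ∀ t, Measurable (V t)) (hZ : Integrable Z P)
    (hVZ : ∀ᵐ ω ∂P, ∀ t ∈ Set.Icc (0 : ℝ) 1, |V t ω| ≤ Z ω) :
    Integrable (supOnUnitInterval V) P := by
  refine hZ.mono' (measurable_supOnUnitInterval hc hm).aestronglyMeasurable ?_
  filter_upwards [hVZ] with ω hω
  rw [Real.norm_eq_abs, abs_le]
  refine ⟨?_, supOnUnitInterval_le fun t ht => (le_abs_self _).trans (hω t ht)⟩
  have h0 : (0 : ℝ) ∈ Set.Icc (0 : ℝ) 1 := by simp
  exact (neg_le_of_abs_le (hω 0 h0)).trans (le_supOnUnitInterval (hc ω) h0)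

lemma measurable_linearResponse (β : ℝ) (hc : ∀ ω, Continuous fun t => V t ω)
    (hm : ∀ t, Measurable (V t)) (t : ℝ) :
    Measurable fun ω => linearResponse β (fun s => V s ω) t := by
  have h := measurable_intervalIntegral (V := fun s ω => Real.exp (β * s) * V s ω)
    (fun ω => (by fun_prop : Continuous fun s : ℝ => Real.exp (β * s)).mul (hc ω))
    (fun s => (hm s).const_mul _) 0 t
  unfold linearResponse
  exact (hm t).sub ((h.const_mul _).const_mul _)

/-- Fubini: the response is linear in the centred input, and the integrable path bound permits the
exchange. -/
lemma integral_linearResponse_eq_zero [SFinite P] (β : ℝ) (hc : ∀ ω, Continuous fun t => V t ω)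
    (hm : ∀ t, Measurable (V t)) (hZ : Integrable Z P)
    (hVZ : ∀ᵐ ω ∂P, ∀ t ∈ Set.Icc (0 : ℝ) 1, |V t ω| ≤ Z ω)
    (hmean : ∀ t ∈ Set.Icc (0 : ℝ) 1, ∫ ω, V t ω ∂P = 0) {t : ℝ} (ht : t ∈ Set.Icc (0 : ℝ) 1) :
    ∫ ω, linearResponse β (fun s => V s ω) t ∂P = 0 := by
  have hc' : ∀ ω, Continuous fun s => Real.exp (β * s) * V s ω := fun ω =>
    (by fun_prop : Continuous fun s : ℝ => Real.exp (β * s)).mul (hc ω)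
  have hm' : ∀ s, Measurable fun ω => Real.exp (β * s) * V s ω := fun s => (hm s).const_mul _
  have hZ' : ∀ᵐ ω ∂P, ∀ s ∈ Set.Icc (0 : ℝ) 1,
      |Real.exp (β * s) * V s ω| ≤ Real.exp |β| * Z ω := by
    filter_upwards [hVZ] with ω hω s hs
    rw [abs_mul, abs_of_pos (Real.exp_pos _)]
    refine mul_le_mul ?_ (hω s hs) (abs_nonneg _) (Real.exp_pos _).le
    gcongr
    calc β * s ≤ |β| * s := mul_le_mul_of_nonneg_right (le_abs_self β) hs.1
      _ ≤ |β| := mul_le_of_le_one_right (abs_nonneg _) hs.2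
  have hI := integrable_intervalIntegral_of_abs_le hc' hm' (hZ.const_mul _) hZ' ht
  have hswap := intervalIntegral_integral_swap
    (integrable_uncurry_of_abs_le hc' hm' (hZ.const_mul _) hZ' ht)
  have hzero : ∫ s in (0 : ℝ)..t, ∫ ω, Real.exp (β * s) * V s ω ∂P = 0 := by
    rw [intervalIntegral.integral_congr (g := fun _ => (0 : ℝ)) fun s hs => ?_]
    · simp
    · rw [Set.uIcc_of_le ht.1] at hs
      simp only [integral_const_mul, hmean s ⟨hs.1, hs.2.trans ht.2⟩, mul_zero]
  unfold linearResponse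
  rw [integral_sub (integrable_of_abs_le hm hZ hVZ ht) ((hI.const_mul _).const_mul _),
    integral_const_mul, integral_const_mul, ← hswap, hzero, hmean t ht]
  simp

/-- The expected maximum of the response controls that of the input. -/
lemma integral_sup_le_mul_integral_sup_linearResponse [IsProbabilityMeasure P] (β : ℝ)
    (hc : ∀ ω, Continuous fun t => V t ω)
    (hm : ∀ t, Measurable (V t)) (h0 : ∀ ω, V 0 ω = 0) (hZ : Integrable Z P)
    (hVZ : ∀ᵐ ω ∂P, ∀ t ∈ Set.Icc (0 : ℝ) 1, |V t ω| ≤ Z ω)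
    (hmean : ∀ t ∈ Set.Icc (0 : ℝ) 1, ∫ ω, V t ω ∂P = 0) :
    ∫ ω, supOnUnitInterval V ω ∂P ≤ (1 + 2 * |β|) *
      ∫ ω, supOnUnitInterval (fun t ω => linearResponse β (fun s => V s ω) t) ω ∂P := by
  set W : ℝ → Ω → ℝ := fun t ω => linearResponse β (fun s => V s ω) t with hW
  have hWc : ∀ ω, Continuous fun t => W t ω := fun ω => continuous_linearResponse (hc ω)
  have hWm : ∀ t, Measurable (W t) := measurable_linearResponse β hc hm
  have hWZ : ∀ᵐ ω ∂P, ∀ t ∈ Set.Icc (0 : ℝ) 1,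
      |W t ω| ≤ (1 + |β| * (Real.exp |β| * Real.exp |β|)) * Z ω := by
    filter_upwards [hVZ] with ω hω t ht using abs_linearResponse_le (Z ω) hω ht
  have hZ2 := hZ.const_mul (1 + |β| * (Real.exp |β| * Real.exp |β|))
  have hsupW := integrable_supOnUnitInterval_of_abs_le hWc hWm hZ2 hWZ
  have h1 : (1 : ℝ) ∈ Set.Icc (0 : ℝ) 1 := by simp
  have hac : ∀ ω, Continuous fun t => |W t ω| := fun ω => (hWc ω).abs
  have ham : ∀ t, Measurable fun ω => |W t ω| := fun t => (hWm t).abs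
  have haZ : ∀ᵐ ω ∂P, ∀ t ∈ Set.Icc (0 : ℝ) 1,
      |(|W t ω|)| ≤ (1 + |β| * (Real.exp |β| * Real.exp |β|)) * Z ω := by
    simpa only [abs_abs] using hWZ
  have hIabs := integrable_intervalIntegral_of_abs_le hac ham hZ2 haZ h1
  -- The integral equation is read backwards, expressing the input through the response.
  have hpath : ∀ ω, supOnUnitInterval V ω
      ≤ supOnUnitInterval W ω + |β| * ∫ s in (0 : ℝ)..1, |W s ω| := by
    intro ω
    refine supOnUnitInterval_le fun t ht => ?_
    have he : W t ω = -β * (∫ s in (0 : ℝ)..t, W s ω) + V t ω := linearResponse_eq (hc ω) t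
    have hle : |∫ s in (0 : ℝ)..t, W s ω| ≤ ∫ s in (0 : ℝ)..1, |W s ω| := by
      refine (intervalIntegral.abs_integral_le_integral_abs ht.1).trans ?_
      exact intervalIntegral.integral_mono_interval le_rfl ht.1 ht.2
        (.of_forall fun s => abs_nonneg _) ((hac ω).intervalIntegrable _ _)
    calc V t ω = W t ω + β * ∫ s in (0 : ℝ)..t, W s ω := by rw [he]; ring
      _ ≤ supOnUnitInterval W ω + |β| * |∫ s in (0 : ℝ)..t, W s ω| := by
          rw [← abs_mul]
          exact add_le_add (le_supOnUnitInterval (hWc ω) ht) (le_abs_self _)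
      _ ≤ _ := by gcongr
  -- Since W_s ≤ sup W and sup W ≥ W_0 = 0, one has |W_s| ≤ 2 sup W - W_s, and the last term has
  -- mean zero.
  have habs : ∀ s ∈ Set.Icc (0 : ℝ) 1, ∫ ω, |W s ω| ∂P ≤ 2 * ∫ ω, supOnUnitInterval W ω ∂P := by
    intro s hs
    have hWi := integrable_of_abs_le hWm hZ2 hWZ hs
    have hW0 : ∫ ω, W s ω ∂P = 0 := integral_linearResponse_eq_zero β hc hm hZ hVZ hmean hs
    calc ∫ ω, |W s ω| ∂P ≤ ∫ ω, (2 * supOnUnitInterval W ω - W s ω) ∂P := by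
          refine integral_mono hWi.abs ((hsupW.const_mul 2).sub hWi) fun ω => ?_
          have h2 := le_supOnUnitInterval (hWc ω) hs
          have h3 := le_supOnUnitInterval (hWc ω) (show (0 : ℝ) ∈ Set.Icc (0 : ℝ) 1 by simp)
          have h4 : W 0 ω = 0 := linearResponse_zero (h0 ω)
          rw [h4] at h3
          change |W s ω| ≤ 2 * supOnUnitInterval W ω - W s ω
          rw [abs_le]
          constructor <;> linarith
      _ = _ := by rw [integral_sub (hsupW.const_mul 2) hWi, hW0, integral_const_mul, sub_zero]
  have hswap := intervalIntegral_integral_swap (integrable_uncurry_of_abs_le hac ham hZ2 haZ h1)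
  have hdouble : ∫ ω, (∫ s in (0 : ℝ)..1, |W s ω|) ∂P ≤ 2 * ∫ ω, supOnUnitInterval W ω ∂P := by
    rw [← hswap]
    have hint : IntervalIntegrable (fun s => ∫ ω, |W s ω| ∂P) volume 0 1 := by
      rw [intervalIntegrable_iff]
      exact (integrable_uncurry_of_abs_le hac ham hZ2 haZ h1).integral_prod_left
    have := intervalIntegral.integral_mono_on zero_le_one hint
      (intervalIntegrable_const (c := 2 * ∫ ω, supOnUnitInterval W ω ∂P)) habs
    simpa using this
  calc ∫ ω, supOnUnitInterval V ω ∂P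
      ≤ ∫ ω, (supOnUnitInterval W ω + |β| * ∫ s in (0 : ℝ)..1, |W s ω|) ∂P :=
        integral_mono (integrable_supOnUnitInterval_of_abs_le hc hm hZ hVZ)
          (hsupW.add (hIabs.const_mul _)) hpath
    _ = ∫ ω, supOnUnitInterval W ω ∂P + |β| * ∫ ω, (∫ s in (0 : ℝ)..1, |W s ω|) ∂P := by
        rw [integral_add hsupW (hIabs.const_mul _), integral_const_mul]
    _ ≤ ∫ ω, supOnUnitInterval W ω ∂P + |β| * (2 * ∫ ω, supOnUnitInterval W ω ∂P) := by gcongr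
    _ = _ := by ring

end

/-! ### Assembly of the theorem. -/

lemma supOnUnitInterval_const_mul {Ω : Type*} {V : ℝ → Ω → ℝ} {σ : ℝ} (hσ : 0 ≤ σ) {ω : Ω} :
    supOnUnitInterval (fun t ω => σ * V t ω) ω = σ * supOnUnitInterval V ω :=
  (Real.mul_iSup_of_nonneg hσ _).symm

lemma log_exp_div_exp (β : ℝ) :
    Real.log (Real.exp (-2 * |β|) / Real.exp (-(1 / 2))) = 1 / 2 - 2 * |β| := by
  rw [← Real.exp_sub, Real.log_exp]
  ring

theorem corollary1 :
    ∃ c : ℝ, 0 < c ∧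
      ∀ (H β σ : ℝ), 0 < H → H < 1 → |β| < 1 →
        0 < σ → σ < Real.exp (2 * |β| - 1 / 2) →
      ∀ (Ω : Type*) [MeasurableSpace Ω] (P : Measure Ω) [IsProbabilityMeasure P]
        (B X : ℝ → Ω → ℝ),
        IsFractionalBrownianMotion H 1 B P →
        IsFractionalOU β σ 1 B X P →
        -- the process is `σ` times the process with unit noise
        (∃ Y : ℝ → Ω → ℝ, IsFractionalOU β 1 1 B Y P) ∧
        (∀ Y : ℝ → Ω → ℝ, IsFractionalOU β 1 1 B Y P →
          (∀ᵐ ω ∂P, ∀ t ∈ Set.Icc (0 : ℝ) 1, X t ω = σ * Y t ω) ∧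
          ∫ ω, supOnUnitInterval X ω ∂P = σ * ∫ ω, supOnUnitInterval Y ω ∂P) ∧
        -- the expected supremum is well defined and finite
        Integrable (supOnUnitInterval X) P ∧
        -- the lower bound
        (|β| ≤ 1 / 4 →
          σ * (c * (Real.exp (-(1 / 2)) *
              Real.sqrt ((1 / H) *
                Real.log (Real.exp (-2 * |β|) / Real.exp (-(1 / 2))))))
            ≤ ∫ ω, supOnUnitInterval X ω ∂P) ∧
        -- the radicand is nonnegative exactly for `|β| ≤ 1/4`, positive exactly for `|β| < 1/4`
        (0 ≤ (1 / H) * Real.log (Real.exp (-2 * |β|) / Real.exp (-(1 / 2))) ↔ |β| ≤ 1 / 4) ∧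
        (0 < (1 / H) * Real.log (Real.exp (-2 * |β|) / Real.exp (-(1 / 2))) ↔ |β| < 1 / 4) := by

  -- 1/90 is 1/60, from the bound for fractional Brownian motion, divided by 3/2 ≥ 1 + 2|β|.
  refine ⟨1 / 90, by norm_num, ?_⟩
  intro H β σ hH _ _ hσ _ Ω _ P _ B X hB hX
  obtain ⟨U, hU, hc, hm, h0, hBU⟩ := hB.exists_continuous_version hH
  obtain ⟨Z, hZ, hUZ⟩ := hU.exists_integrable_bound hH hc hm h0
  set V : ℝ → Ω → ℝ := fun t ω => linearResponse β (fun s => U s ω) t with hV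
  have hVc : ∀ ω, Continuous fun t => V t ω := fun ω => continuous_linearResponse (hc ω)
  have hVm : ∀ t, Measurable (V t) := measurable_linearResponse β hc hm
  have hVZ : ∀ᵐ ω ∂P, ∀ t ∈ Set.Icc (0 : ℝ) 1,
      |V t ω| ≤ (1 + |β| * (Real.exp |β| * Real.exp |β|)) * Z ω := by
    filter_upwards [hUZ] with ω hω t ht using abs_linearResponse_le (Z ω) hω ht
  have hVint := integrable_supOnUnitInterval_of_abs_le hVc hVm (hZ.const_mul _) hVZ
  have hXV : ∀ᵐ ω ∂P, ∀ t ∈ Set.Icc (0 : ℝ) 1, X t ω = σ * V t ω :=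
    hX.ae_eq_mul_linearResponse hc h0 hBU
  have hXsup : supOnUnitInterval X =ᵐ[P] fun ω => σ * supOnUnitInterval V ω := by
    filter_upwards [hXV] with ω hω
    rw [← supOnUnitInterval_const_mul hσ.le]
    exact supOnUnitInterval_congr hω
  have hXint : ∫ ω, supOnUnitInterval X ω ∂P = σ * ∫ ω, supOnUnitInterval V ω ∂P := by
    rw [integral_congr_ae hXsup, integral_const_mul]
  rw [log_exp_div_exp]
  refine ⟨⟨V, isFractionalOU_linearResponse hc h0 hBU⟩, fun Y hY => ?_,
    (hVint.const_mul σ).congr hXsup.symm, fun hβ => ?_, ?_, ?_⟩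
  · have hYV : ∀ᵐ ω ∂P, ∀ t ∈ Set.Icc (0 : ℝ) 1, Y t ω = V t ω := by
      filter_upwards [hY.ae_eq_mul_linearResponse hc h0 hBU] with ω hω t ht
      rw [hω t ht, one_mul]
    constructor
    · filter_upwards [hXV, hYV] with ω h1 h2 t ht
      rw [h1 t ht, h2 t ht]
    · rw [hXint]
      congr 1
      refine integral_congr_ae ?_
      filter_upwards [hYV] with ω hω
      exact (supOnUnitInterval_congr hω).symm
  · rw [hXint]
    refine mul_le_mul_of_nonneg_left ?_ hσ.le
    have h1 := hU.inv_sqrt_le_integral_sup hH hc h0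
      (integrable_supOnUnitInterval_of_abs_le hc hm hZ hUZ)
    have h2 := integral_sup_le_mul_integral_sup_linearResponse β hc hm h0 hZ hUZ hU.centered
    have h3 : 0 ≤ ∫ ω, supOnUnitInterval V ω ∂P := by
      refine integral_nonneg fun ω => ?_
      rw [Pi.zero_apply, ← linearResponse_zero (β := β) (u := fun s => U s ω) (h0 ω)]
      exact le_supOnUnitInterval (hVc ω) (by simp)
    have h4 : (1 + 2 * |β|) * ∫ ω, supOnUnitInterval V ω ∂P
        ≤ 3 / 2 * ∫ ω, supOnUnitInterval V ω ∂P := by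
      gcongr
      linarith
    -- The logarithm is at most 1/2, so the bound proved, with √(1/H) alone, is stronger than the
    -- one claimed.
    have h5 : √(1 / H * (1 / 2 - 2 * |β|)) ≤ √(1 / H) := by
      apply Real.sqrt_le_sqrt
      exact mul_le_of_le_one_right (by positivity) (by linarith [abs_nonneg β])
    have h6 : Real.exp (-(1 / 2)) * √(1 / H * (1 / 2 - 2 * |β|)) ≤ √(1 / H) :=
      (mul_le_of_le_one_left (Real.sqrt_nonneg _) (Real.exp_le_one_iff.2 (by norm_num))).trans h5
    linarith
  · rw [mul_nonneg_iff_of_pos_left (by positivity)]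
    constructor <;> intro h <;> linarith
  · rw [mul_pos_iff_of_pos_left (by positivity)]
    constructor <;> intro h <;> linarith
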